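/- Let $k$ be a field; all algebras are unitary, associative and commutative, and $\otimes=\otimes_k$. A *left counital bialgebra* $(H,m,\mu,\Delta,\varepsilon)$ is a $k$-algebra $(H,m,\mu)$ with algebra homomorphisms $\Delta:H\to H\otimes H$ and $\varepsilon:H\to k$ such that $\Delta$ is coassociative and $(\varepsilon\otimes \mathrm{id})\Delta(x)=1\otimes x$ for all $x$ (right counicity is not required). It is *graded* by subspaces $H^{(n)}$, $n\ge 0$, if $H=\bigoplus_{n\ge0}H^{(n)}$, $H^{(p)}H^{(q)}\subseteq H^{(p+q)}$ and $\Delta(H^{(n)})\subseteq (H^{(0)}\otimes H^{(n)})\oplus\bigoplus_{p+q=n,\;p,q>0}H^{(p)}\otimes H^{(q)}$; the graded left counital bialgebra is *connected* if $H^{(0)}=\mathrm{im}\,\mu$ and $\ker\varepsilon=\bigoplus_{n\ge1}H^{(n)}$. It is a *left counital (right antipode) Hopf algebra* if there is a linear map $S:H\to H$ with $m(\mathrm{id}\otimes S)\Delta=\mu\varepsilon$. For a left counital bialgebra $A=(A,m_A,\mu_A,\Delta_A,\varepsilon_A)$ let Ш$_N(A)=\bigoplus_{m\ge1}A^{\otimes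 m}$, with $P_r(\mathfrak a)=1_A\otimes\mathfrak a$ and with the bilinear product $\diamond$ given recursively, for $a,b\in A$ and pure tensors $\mathfrak a',\mathfrak b'$, by $a\diamond b=ab$, $a\diamond(b\otimes\mathfrak b')=ab\otimes\mathfrak b'$, $(a\otimes\mathfrak a')\diamond b=ab\otimes\mathfrak a'$ and $$(a\otimes\mathfrak a')\diamond(b\otimes\mathfrak b')=ab\otimes\big(\mathfrak a'\diamond(1_A\otimes\mathfrak b')+(1_A\otimes\mathfrak a')\diamond\mathfrak b'-1_A\otimes(\mathfrak a'\diamond\mathfrak b')\big).$$ Its unit map is $c\mapsto c1_A\in A$. Its coproduct is given by $\Delta(a)=\Delta_A(a)$ and $\Delta(a\otimes\mathfrak a')=\Delta_A(a)\bullet(\mathrm{id}\otimes P_r)\Delta(\mathfrak a')$, where $\bullet$ is the product of Ш$_N(A)\,\otimes\,$Ш$_N(A)$, and its counit by $\varepsilon(a_1\otimes\cdots\otimes a_m)=\varepsilon_A(a_1)\cdots\varepsilon_A(a_m)$. **Theorem.** Let $A=\bigoplus_{n\ge0}A^{(n)}$ be a connected graded left counital bialgebra over $k$. For $d\ge 0$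 let $U^{(d)}\subseteq$ Ш$_N(A)$ be the span of all pure tensors $a_1\otimes\cdots\otimes a_m$, $m\ge1$, with $a_i\in A^{(d_i)}$ and $d_1+\cdots+d_m+m-1=d$. Then: 1. Ш$_N(A)$ is a left counital bialgebra, graded by the subspaces $U^{(d)}$, $d\ge0$, and $U^{(0)}=k1_A$ is the image of the unit map. 2. Ш$_N(A)$ is connected graded for a suitable grading, that is, there are subspaces $H^{(n)}$, $n\geq 0$, of Ш$_N(A)$ for which it is a connected graded left counital bialgebra. 3. Ш$_N(A)$ is a left counital right-antipode Hopf algebra. -/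

import Mathlib

open scoped TensorProduct DirectSum

noncomputable section

/-! ### Left counital bialgebras, gradings, connectedness, right antipodes

The data of a bialgebra on a `k`-module `H` are linear maps
`m : H → H → H` (bilinear), `u : k → H`, `Δ : H → H ⊗ H`, `ε : H → k`. -/

namespace LeftCounital

universe u v

variable {k : Type u} [CommRing k] {H : Type v} [AddCommMonoid H] [Module k H]

/-- The multiplication `(x ⊗ y) • (x' ⊗ y') = xx' ⊗ yy'` on `H ⊗ H` induced by a multiplication
on `H`. -/
def tensorMul (m : H →ₗ[k] H →ₗ[k] H) : (H ⊗[k] H) →ₗ[k] (H ⊗[k] H) →ₗ[k] (H ⊗[k] H) :=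
  TensorProduct.map₂ m m

/-- The convolution product `f * g = m ∘ (f ⊗ g) ∘ Δ` of linear endomorphisms of `H`. -/
def convolution (m : H →ₗ[k] H →ₗ[k] H) (Δ : H →ₗ[k] H ⊗[k] H) (f g : H →ₗ[k] H) : H →ₗ[k] H :=
  TensorProduct.lift m ∘ₗ TensorProduct.map f g ∘ₗ Δ

/-- `(H, m, u, Δ, ε)` is a left counital bialgebra: `(H, m, u)` is a unitary commutative
(associative) algebra, `Δ` and `ε` are algebra homomorphisms, `Δ` is coassociative, and
`(ε ⊗ id) Δ (x) = 1 ⊗ x`. No right counit property is required. -/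
structure IsBialgebra (m : H →ₗ[k] H →ₗ[k] H) (u : k →ₗ[k] H)
    (Δ : H →ₗ[k] H ⊗[k] H) (ε : H →ₗ[k] k) : Prop where
  mul_assoc : ∀ x y z, m (m x y) z = m x (m y z)
  mul_comm : ∀ x y, m x y = m y x
  one_mul : ∀ x, m (u 1) x = x
  comul_mul : ∀ x y, Δ (m x y) = tensorMul m (Δ x) (Δ y)
  comul_one : Δ (u 1) = u 1 ⊗ₜ[k] u 1
  counit_mul : ∀ x y, ε (m x y) = ε x * ε y
  counit_one : ε (u 1) = 1
  coassoc : ∀ x, TensorProduct.assoc k H H H (TensorProduct.map Δ LinearMap.id (Δ x)) =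
    TensorProduct.map LinearMap.id Δ (Δ x)
  left_counit : ∀ x, TensorProduct.map ε LinearMap.id (Δ x) = (1 : k) ⊗ₜ[k] x

/-- The subspace `P ⊗ Q` of `H ⊗ H`, for subspaces `P` and `Q` of `H`. -/
def tensorSub (P Q : Submodule k H) : Submodule k (H ⊗[k] H) :=
  Submodule.map₂ (TensorProduct.mk k H H) P Q

/-- The left counital bialgebra `H` is graded by the submodules `G n`, `n ≥ 0`:
`H` is the internal direct sum of the `G n`, `G p * G q ⊆ G (p + q)`, and
`Δ (G n) ⊆ G 0 ⊗ G n + ∑_{p + q = n, p > 0, q > 0} G p ⊗ G q`. -/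
structure IsGradedBialgebra (m : H →ₗ[k] H →ₗ[k] H) (u : k →ₗ[k] H)
    (Δ : H →ₗ[k] H ⊗[k] H) (ε : H →ₗ[k] k) (G : ℕ → Submodule k H) : Prop
    extends IsBialgebra m u Δ ε where
  isInternal : DirectSum.IsInternal G
  mul_mem : ∀ p q x y, x ∈ G p → y ∈ G q → m x y ∈ G (p + q)
  comul_mem : ∀ n x, x ∈ G n → Δ x ∈ tensorSub (G 0) (G n) ⊔
    ⨆ (p : ℕ) (q : ℕ) (_ : p + q = n ∧ 0 < p ∧ 0 < q), tensorSub (G p) (G q)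

/-- A graded left counital bialgebra is connected if `G 0 = im u` and
`ker ε = ⨁_{n ≥ 1} G n`. -/
structure IsConnectedGradedBialgebra (m : H →ₗ[k] H →ₗ[k] H) (u : k →ₗ[k] H)
    (Δ : H →ₗ[k] H ⊗[k] H) (ε : H →ₗ[k] k) (G : ℕ → Submodule k H) : Prop
    extends IsGradedBialgebra m u Δ ε G where
  zero_eq : G 0 = LinearMap.range u
  ker_counit : LinearMap.ker ε = ⨆ (n : ℕ) (_ : 1 ≤ n), G n

/-- `S` is a right antipode: `id * S = u ∘ ε` for the convolution product. -/
def IsRightAntipode (m : H →ₗ[k] H →ₗ[k] H) (u : k →ₗ[k] H)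
    (Δ : H →ₗ[k] H ⊗[k] H) (ε : H →ₗ[k] k) (S : H →ₗ[k] H) : Prop :=
  convolution m Δ LinearMap.id S = u ∘ₗ ε

/-- A left counital (right antipode) Hopf algebra: a left counital bialgebra that has a right
antipode. -/
structure IsHopf (m : H →ₗ[k] H →ₗ[k] H) (u : k →ₗ[k] H)
    (Δ : H →ₗ[k] H ⊗[k] H) (ε : H →ₗ[k] k) : Prop extends IsBialgebra m u Δ ε where
  exists_antipode : ∃ S : H →ₗ[k] H, IsRightAntipode m u Δ ε S

end LeftCounital

/-! ### The free commutative Nijenhuis algebra `Ш_N(A) = ⨁_{n ≥ 1} A^{⊗ n}` -/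

namespace ShN

universe u v

variable (k : Type u) [CommRing k] (A : Type v) [CommRing A] [Algebra k A]

/-- The `k`-module `Ш_N(A)`; its `n`-th summand, `n ≥ 0`, is `A^{⊗ (n + 1)}`. -/
abbrev Carrier : Type (max u v) := ⨁ n : ℕ, ⨂[k]^(n + 1) A

/-- The inclusion of the summand `A^{⊗ (n + 1)}`. -/
abbrev incl (n : ℕ) : (⨂[k]^(n + 1) A) →ₗ[k] Carrier k A :=
  DirectSum.lof k ℕ (fun n => ⨂[k]^(n + 1) A) n

/-- The identification `A^{⊗ 1} = A`. -/
def oneEquiv : (⨂[k]^(0 + 1) A) ≃ₗ[k] A :=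
  PiTensorProduct.subsingletonEquiv (R := k) (s := fun _ : Fin 1 => A) 0

/-- The natural embedding `A → Ш_N(A)`. -/
def j : A →ₗ[k] Carrier k A := incl k A 0 ∘ₗ (oneEquiv k A).symm.toLinearMap

/-- `a ↦ a' ↦ a ⊗ a'` on `A^{⊗ (n + 1)}`. -/
def cons (n : ℕ) : A →ₗ[k] (⨂[k]^(n + 1) A) →ₗ[k] (⨂[k]^(n + 2) A) :=
  (PiTensorProduct.lift (R := k) (s := fun _ : Fin (n + 1) => A)).toLinearMap ∘ₗ
    (PiTensorProduct.tprod k (s := fun _ : Fin (n + 2) => A)).curryLeft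

/-- `a₁ ⊗ a₂ ⊗ ⋯ ⊗ a_{n + 2} ↦ a₁ ⊗ (a₂ ⊗ ⋯ ⊗ a_{n + 2})`. -/
def uncons (n : ℕ) : (⨂[k]^(n + 2) A) →ₗ[k] A ⊗[k] (⨂[k]^(n + 1) A) :=
  PiTensorProduct.lift (LinearMap.uncurryLeft (M := fun _ : Fin (n + 2) => A)
    ((PiTensorProduct.lift (R := k) (s := fun _ : Fin (n + 1) => A)).symm.toLinearMap ∘ₗ
      TensorProduct.mk k A (⨂[k]^(n + 1) A)))

/-- `a ↦ w ↦ a ⊗ w` on all of `Ш_N(A)`. -/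
def consAll : A →ₗ[k] Carrier k A →ₗ[k] Carrier k A :=
  (DirectSum.toModule k ℕ (A →ₗ[k] Carrier k A)
    (fun n => ((cons k A n).compr₂ (incl k A (n + 1))).flip)).flip

/-- The right-shift operator `P_r (w) = 1_A ⊗ w`. -/
def shift : Carrier k A →ₗ[k] Carrier k A := consAll k A 1

/-- `a ↦ b ⊗ 𝔟' ↦ ab ⊗ 𝔟'`. -/
def headMul (n : ℕ) : A →ₗ[k] (⨂[k]^(n + 2) A) →ₗ[k] Carrier k A :=
  ((LinearMap.rTensorHom (⨂[k]^(n + 1) A) ∘ₗ LinearMap.mul k A).compl₂ (uncons k A n)).compr₂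
    (incl k A (n + 1) ∘ₗ TensorProduct.lift (cons k A n))

/-- The product of `A^{⊗ (m + 1)}` and `A^{⊗ (n + 1)}`, by recursion on `m + n`:
* `a ⋄ b = ab`;
* `a ⋄ (b ⊗ 𝔟') = ab ⊗ 𝔟'` and `(a ⊗ 𝔞') ⋄ b = ab ⊗ 𝔞'`;
* `(a ⊗ 𝔞') ⋄ (b ⊗ 𝔟') = ab ⊗ (𝔞' ⋄ (1 ⊗ 𝔟') + (1 ⊗ 𝔞') ⋄ 𝔟' - 1 ⊗ (𝔞' ⋄ 𝔟'))`. -/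
def mulAux : (m n : ℕ) → (⨂[k]^(m + 1) A) →ₗ[k] (⨂[k]^(n + 1) A) →ₗ[k] Carrier k A
  | 0, 0 => ((LinearMap.mul k A).compl₁₂
      (oneEquiv k A).toLinearMap (oneEquiv k A).toLinearMap).compr₂ (j k A)
  | 0, n + 1 => headMul k A n ∘ₗ (oneEquiv k A).toLinearMap
  | m + 1, 0 => (headMul k A m ∘ₗ (oneEquiv k A).toLinearMap).flip
  | m + 1, n + 1 =>
    ((TensorProduct.map₂ (LinearMap.mul k A)
        ((mulAux m (n + 1)).compl₂ (cons k A n 1) + mulAux (m + 1) n ∘ₗ cons k A m 1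
          + (-1 : k) • (mulAux m n).compr₂ (shift k A))).compl₁₂
      (uncons k A m) (uncons k A n)).compr₂ (TensorProduct.lift (consAll k A))
  termination_by m n => m + n

/-- The multiplication `⋄` of `Ш_N(A)`. -/
def mul : Carrier k A →ₗ[k] Carrier k A →ₗ[k] Carrier k A :=
  DirectSum.toModule k ℕ _ fun m =>
    (DirectSum.toModule k ℕ ((⨂[k]^(m + 1) A) →ₗ[k] Carrier k A)
      fun n => (mulAux k A m n).flip).flip

/-- The unit map `c ↦ c 1_A`. -/
def unit : k →ₗ[k] Carrier k A := j k A ∘ₗ Algebra.linearMap k A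

variable {A}

/-- The coproduct on `A^{⊗ (n + 1)}`, by recursion: `Δ(a) = Δ_A(a)` for `a ∈ A`, and
`Δ(a ⊗ 𝔞') = Δ_A(a) • (id ⊗ P_r) Δ(𝔞')`. -/
def comulAux (ΔA : A →ₗ[k] A ⊗[k] A) :
    (n : ℕ) → (⨂[k]^(n + 1) A) →ₗ[k] Carrier k A ⊗[k] Carrier k A
  | 0 => TensorProduct.map (j k A) (j k A) ∘ₗ ΔA ∘ₗ (oneEquiv k A).toLinearMap
  | n + 1 =>
    TensorProduct.lift ((LeftCounital.tensorMul (mul k A)).compl₁₂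
      (TensorProduct.map (j k A) (j k A) ∘ₗ ΔA)
      (TensorProduct.map LinearMap.id (shift k A) ∘ₗ comulAux ΔA n)) ∘ₗ uncons k A n

/-- The coproduct of `Ш_N(A)` induced by a coproduct of `A`. -/
def comul (ΔA : A →ₗ[k] A ⊗[k] A) : Carrier k A →ₗ[k] Carrier k A ⊗[k] Carrier k A :=
  DirectSum.toModule k ℕ _ (comulAux k ΔA)

/-- The counit `a₁ ⊗ ⋯ ⊗ a_n ↦ ε_A(a₁) ⋯ ε_A(a_n)` of `Ш_N(A)`. -/
def counit (εA : A →ₗ[k] k) : Carrier k A →ₗ[k] k :=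
  DirectSum.toModule k ℕ _ fun n =>
    PiTensorProduct.lift
      ((MultilinearMap.mkPiAlgebra k (Fin (n + 1)) k).compLinearMap fun _ => εA)

/-- The span of the pure tensors `a₁ ⊗ ⋯ ⊗ a_m`, `m ≥ 1`, of homogeneous elements `a_i` of `A`
with `deg a₁ + ⋯ + deg a_m + m - 1 = d` (here `m = n + 1`). -/
def degSub (G : ℕ → Submodule k A) (d : ℕ) : Submodule k (Carrier k A) :=
  Submodule.span k {w | ∃ (n : ℕ) (a : Fin (n + 1) → A) (e : Fin (n + 1) → ℕ),
    (∀ i, a i ∈ G (e i)) ∧ (∑ i, e i) + n = d ∧ w = incl k A n (PiTensorProduct.tprod k a)}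

end ShN

end

open scoped TensorProduct DirectSum

noncomputable section

namespace ShN

universe u v

/-! ### Words and the recursive product. -/

section Structure

variable (k : Type u) [CommRing k] (A : Type v) [CommRing A] [Algebra k A]

variable {A}

/-! The recursion for `⋄` says that `P_r` is a Nijenhuis operator and that `a ⊗ w = a ⋄ P_r w`.
Hence a linear map `F` from Ш_N(A) to a commutative algebra `B` with `F(a ⊗ w) = f(a) Q(F w)` is
multiplicative as soon as `f` is multiplicative and unital on `A` and `Q` is Nijenhuis on `B`
(`map_mul_of_nijenhuis`). With `Q = id ⊗ P_r` this handles `Δ`, and with `Q = id` on `k` it handles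
`ε`. Coassociativity and the left counit property then pass from `w` to `a ⋄ P_r w`, because `Δ P_r
= (id ⊗ P_r) Δ`.

The subspaces `U^(d)` give a grading, since each recursion respects degree when `P_r` counts as
degree one. This grading is not connected in general: `ε P_r = ε`, so `ε(1 ⊗ 1) = 1` although `1 ⊗
1` has degree one. The remedy is to replace `P_r` by `P_r - id`, which is again Nijenhuis and is
killed by `ε`. The same multiplicativity criterion yields an algebra endomorphism `twist` that fixes
`A` and carries `P_r` to `P_r - id`. It is inverted by `untwist`, built from `P_r + id`, and it
commutes with `Δ` (`comul_twist`). The images of the `U^(d)` under `twist` therefore still form a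
grading, and now the positive degrees lie in `ker ε` (`isConnectedGradedBialgebra`).

In a connected grading, `Δ x - 1 ⊗ x` has right factors only of degree below that of `x`, so the
antipode equation can be solved degree by degree (`exists_rightAntipode`). -/

theorem cons_tprod (n : ℕ) (a : A) (b : Fin (n + 1) → A) :
    cons k A n a (PiTensorProduct.tprod k b) =
      PiTensorProduct.tprod k (Fin.cons a b : Fin (n + 2) → A) := by
  simp [cons]

theorem uncons_tprod (n : ℕ) (b : Fin (n + 2) → A) :
    uncons k A n (PiTensorProduct.tprod k b) =
      b 0 ⊗ₜ[k] PiTensorProduct.tprod k (Fin.tail b) := by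
  simp [uncons]

theorem tprod_eq_cons (n : ℕ) (b : Fin (n + 2) → A) :
    PiTensorProduct.tprod k b = cons k A n (b 0) (PiTensorProduct.tprod k (Fin.tail b)) := by
  rw [cons_tprod, Fin.cons_self_tail]

theorem uncons_cons (n : ℕ) (a : A) (x : ⨂[k]^(n + 1) A) :
    uncons k A n (cons k A n a x) = a ⊗ₜ[k] x := by
  induction x using PiTensorProduct.induction_on with
  | smul_tprod r f => simp [cons_tprod, uncons_tprod]
  | add x y hx hy => simp [hx, hy, TensorProduct.tmul_add]

theorem oneEquiv_tprod (b : Fin 1 → A) : oneEquiv k A (PiTensorProduct.tprod k b) = b 0 := by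
  simp [oneEquiv]

theorem j_oneEquiv (x : ⨂[k]^(0 + 1) A) : j k A (oneEquiv k A x) = incl k A 0 x := by
  simp [j]

theorem j_apply (a : A) : j k A a = incl k A 0 ((oneEquiv k A).symm a) := rfl

theorem incl_tprod_zero (b : Fin 1 → A) :
    incl k A 0 (PiTensorProduct.tprod k b) = j k A (b 0) := by
  rw [← j_oneEquiv, oneEquiv_tprod]

theorem consAll_incl (n : ℕ) (a : A) (x : ⨂[k]^(n + 1) A) :
    consAll k A a (incl k A n x) = incl k A (n + 1) (cons k A n a x) := by
  simp [consAll]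

theorem incl_tprod_succ (n : ℕ) (b : Fin (n + 2) → A) :
    incl k A (n + 1) (PiTensorProduct.tprod k b) =
      consAll k A (b 0) (incl k A n (PiTensorProduct.tprod k (Fin.tail b))) := by
  rw [tprod_eq_cons, consAll_incl]

variable {k}

theorem carrier_induction {p : Carrier k A → Prop} (hj : ∀ a, p (j k A a))
    (hcons : ∀ a w, p w → p (consAll k A a w)) (hadd : ∀ x y, p x → p y → p (x + y))
    (w : Carrier k A) : p w := by
  induction w using DirectSum.induction_on with
  | zero => simpa using hj 0
  | add x y hx hy => exact hadd x y hx hy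
  | of n x =>
    change p (incl k A n x)
    induction n with
    | zero => rw [← j_oneEquiv]; exact hj _
    | succ n ih =>
      induction x using PiTensorProduct.induction_on with
      | smul_tprod r f =>
        -- The scalar is absorbed into the first letter, so the principle needs no case for scalar
        -- multiples.
        rw [map_smul, incl_tprod_succ, ← LinearMap.smul_apply, ← map_smul]
        exact hcons _ _ (ih _)
      | add x y hx hy => rw [map_add]; exact hadd _ _ hx hy

variable (k) in
/-- The word `a ⊗ b₁ ⊗ ⋯ ⊗ b_n`, for a list `b₁, …, b_n`. -/
def word : A → List A → Carrier k A
  | a, [] => j k A a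
  | a, b :: l => consAll k A a (word b l)

theorem closure_word :
    AddSubmonoid.closure {w | ∃ (a : A) (l : List A), w = word k a l} = ⊤ := by
  rw [eq_top_iff]
  rintro w -
  induction w using carrier_induction with
  | hj a => exact AddSubmonoid.subset_closure ⟨a, [], rfl⟩
  | hadd x y hx hy => exact add_mem hx hy
  | hcons a w hw =>
    induction hw using AddSubmonoid.closure_induction with
    | mem x hx =>
      obtain ⟨b, l, rfl⟩ := hx
      exact AddSubmonoid.subset_closure ⟨a, b :: l, rfl⟩
    | zero => simp
    | add x y _ _ hx hy => rw [map_add]; exact add_mem hx hy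

/-- The product recursion shortens tensors but puts new letters `1` in front, so identities about it
need induction on total length. Reduction to words makes that length available. -/
theorem word_induction {p : Carrier k A → Prop} (hword : ∀ a l, p (word k a l))
    (hadd : ∀ x y, p x → p y → p (x + y)) (w : Carrier k A) : p w := by
  have hw : w ∈ AddSubmonoid.closure {w | ∃ (a : A) (l : List A), w = word k a l} := by
    simp [closure_word]
  induction hw using AddSubmonoid.closure_induction with
  | mem x hx => obtain ⟨b, l, rfl⟩ := hx; exact hword b l
  | zero => simpa [word] using hword 0 []
  | add x y _ _ hx hy => exact hadd x y hx hy

/-! ### The product -/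

theorem mul_incl (m n : ℕ) (x : ⨂[k]^(m + 1) A) (y : ⨂[k]^(n + 1) A) :
    mul k A (incl k A m x) (incl k A n y) = mulAux k A m n x y := by
  simp [mul]

theorem shift_apply (w : Carrier k A) : shift k A w = consAll k A 1 w := rfl

theorem headMul_cons (n : ℕ) (a b : A) (y : ⨂[k]^(n + 1) A) :
    headMul k A n a (cons k A n b y) = consAll k A (a * b) (incl k A n y) := by
  simp [headMul, uncons_cons, consAll_incl]

theorem mul_j_j (a b : A) : mul k A (j k A a) (j k A b) = j k A (a * b) := by
  rw [j_apply k a, j_apply k b, mul_incl, mulAux]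
  simp

theorem mul_j_consAll (a b : A) (y : Carrier k A) :
    mul k A (j k A a) (consAll k A b y) = consAll k A (a * b) y := by
  induction y using DirectSum.induction_on with
  | zero => simp
  | add x y hx hy => simp only [map_add, hx, hy]
  | of n y =>
    change mul k A (j k A a) (consAll k A b (incl k A n y)) = consAll k A (a * b) (incl k A n y)
    rw [consAll_incl k, j_apply, mul_incl, mulAux]
    simp [headMul_cons]

theorem mul_consAll_j (a b : A) (x : Carrier k A) :
    mul k A (consAll k A a x) (j k A b) = consAll k A (a * b) x := by
  induction x using DirectSum.induction_on with
  | zero => simp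
  | add x y hx hy => simp only [map_add, LinearMap.add_apply, hx, hy]
  | of n x =>
    change mul k A (consAll k A a (incl k A n x)) (j k A b) = consAll k A (a * b) (incl k A n x)
    rw [consAll_incl k, j_apply, mul_incl, mulAux]
    simp [headMul_cons, mul_comm]

theorem mul_consAll_consAll (a b : A) (x y : Carrier k A) :
    mul k A (consAll k A a x) (consAll k A b y) = consAll k A (a * b)
      (mul k A x (shift k A y) + mul k A (shift k A x) y - shift k A (mul k A x y)) := by
  induction x using DirectSum.induction_on with
  | zero => simp
  | add x x' hx hx' =>
    simp only [map_add, LinearMap.add_apply, hx, hx', map_sub]; abel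
  | of m x =>
    induction y using DirectSum.induction_on with
    | zero => simp
    | add y y' hy hy' =>
      simp only [map_add, hy, hy', map_sub]; abel
    | of n y =>
      change mul k A (consAll k A a (incl k A m x)) (consAll k A b (incl k A n y)) =
        consAll k A (a * b) (mul k A (incl k A m x) (shift k A (incl k A n y))
          + mul k A (shift k A (incl k A m x)) (incl k A n y)
          - shift k A (mul k A (incl k A m x) (incl k A n y)))
      simp only [shift_apply, consAll_incl, mul_incl]
      rw [mulAux]
      simp [uncons_cons, shift_apply, sub_eq_add_neg]

theorem mul_shift_shift (x y : Carrier k A) :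
    mul k A (shift k A x) (shift k A y) = shift k A
      (mul k A x (shift k A y) + mul k A (shift k A x) y - shift k A (mul k A x y)) := by
  simp only [shift_apply, mul_consAll_consAll, mul_one]

theorem mul_one_left (x : Carrier k A) : mul k A (unit k A 1) x = x := by
  simp only [unit, LinearMap.comp_apply, Algebra.linearMap_apply, map_one]
  induction x using carrier_induction with
  | hj a => rw [mul_j_j, one_mul]
  | hcons a w _ => rw [mul_j_consAll, one_mul]
  | hadd x y hx hy => rw [map_add, hx, hy]

theorem shift_word (a : A) (l : List A) : shift k A (word k a l) = word k 1 (a :: l) := rfl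

theorem mul_comm_word (n : ℕ) (a b : A) (l l' : List A) (h : l.length + l'.length ≤ n) :
    mul k A (word k a l) (word k b l') = mul k A (word k b l') (word k a l) := by
  induction n generalizing a b l l' with
  | zero =>
    obtain ⟨rfl, rfl⟩ : l = [] ∧ l' = [] := by
      simpa [List.length_eq_zero_iff] using h
    simp only [word, mul_j_j, mul_comm]
  | succ n ih =>
    rcases l with - | ⟨c, l⟩ <;> rcases l' with - | ⟨d, l'⟩ <;> simp only [List.length_cons, List.length_nil] at h
    · simp only [word, mul_j_j, mul_comm]
    · simp only [word, mul_j_consAll, mul_consAll_j, mul_comm]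
    · simp only [word, mul_j_consAll, mul_consAll_j, mul_comm]
    · simp only [word, mul_consAll_consAll, shift_word]
      rw [ih c d l l' (by omega), ← word, ← word, ih c 1 l (d :: l') (by simp; omega),
        ih 1 d (c :: l) l' (by simp; omega), mul_comm a b,
        add_comm (mul k A (word k 1 (d :: l')) _)]

protected theorem mul_comm (x y : Carrier k A) : mul k A x y = mul k A y x := by
  induction x using word_induction with
  | hadd x x' hx hx' => simp only [map_add, LinearMap.add_apply, hx, hx']
  | hword a l =>
    induction y using word_induction with
    | hadd y y' hy hy' => simp only [map_add, LinearMap.add_apply, hy, hy']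
    | hword b l' => exact mul_comm_word _ a b l l' le_rfl

/-- If the triples of words obtained by shifting two of `x, y, z` or one or none of them
associate, then so do all `a ⊗ x`, `b ⊗ y`, `c ⊗ z`. -/
theorem mul_assoc_consAll (a b c : A) {x y z : Carrier k A}
    (h₀ : mul k A (mul k A x y) z = mul k A x (mul k A y z))
    (h₁ : mul k A (mul k A (shift k A x) y) z = mul k A (shift k A x) (mul k A y z))
    (h₂ : mul k A (mul k A x (shift k A y)) z = mul k A x (mul k A (shift k A y) z))
    (h₃ : mul k A (mul k A x y) (shift k A z) = mul k A x (mul k A y (shift k A z)))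
    (h₁₂ : mul k A (mul k A (shift k A x) (shift k A y)) z =
      mul k A (shift k A x) (mul k A (shift k A y) z))
    (h₁₃ : mul k A (mul k A (shift k A x) y) (shift k A z) =
      mul k A (shift k A x) (mul k A y (shift k A z)))
    (h₂₃ : mul k A (mul k A x (shift k A y)) (shift k A z) =
      mul k A x (mul k A (shift k A y) (shift k A z))) :
    mul k A (mul k A (consAll k A a x) (consAll k A b y)) (consAll k A c z) =
      mul k A (consAll k A a x) (mul k A (consAll k A b y) (consAll k A c z)) := by
  simp only [mul_consAll_consAll, mul_assoc]
  congr 1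
  -- After the common head `abc` is removed, the products of shifted factors that remain on either
  -- side are expanded by the Nijenhuis identity.
  have e₁ := mul_shift_shift (mul k A x y) z
  have e₂ := mul_shift_shift x (mul k A y z)
  simp only [map_add, map_sub, LinearMap.add_apply, LinearMap.sub_apply] at e₁ e₂ ⊢
  rw [mul_shift_shift x y] at h₁₂
  rw [mul_shift_shift y z] at h₂₃
  simp only [map_add, map_sub, LinearMap.add_apply, LinearMap.sub_apply] at h₁₂ h₂₃
  rw [e₁, e₂, h₂₃, h₁₃, h₀, h₁, h₂, h₃, ← h₁₂]
  abel

theorem mul_assoc_word (n : ℕ) (a b c : A) (l l' l'' : List A)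
    (h : l.length + l'.length + l''.length ≤ n) :
    mul k A (mul k A (word k a l) (word k b l')) (word k c l'') =
      mul k A (word k a l) (mul k A (word k b l') (word k c l'')) := by
  induction n generalizing a b c l l' l'' with
  | zero =>
    obtain ⟨⟨rfl, rfl⟩, rfl⟩ : (l = [] ∧ l' = []) ∧ l'' = [] := by
      simpa [List.length_eq_zero_iff] using h
    simp only [word, mul_j_j, mul_assoc]
  | succ n ih =>
    rcases l with - | ⟨d, l⟩ <;> rcases l' with - | ⟨e, l'⟩ <;> rcases l'' with - | ⟨f, l''⟩ <;>
      simp only [List.length_cons, List.length_nil] at h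
    case cons.cons.cons =>
      -- Three letters are removed and at most two come back as shifts, so the total length drops in
      -- all seven instances.
      apply mul_assoc_consAll <;> (try simp only [shift_word]) <;> apply ih <;>
        (try simp only [List.length_cons]) <;> omega
    all_goals
      simp only [word, mul_j_j, mul_j_consAll, mul_consAll_j, mul_consAll_consAll, mul_assoc]

protected theorem mul_assoc (x y z : Carrier k A) :
    mul k A (mul k A x y) z = mul k A x (mul k A y z) := by
  induction x using word_induction with
  | hadd x x' hx hx' => simp only [map_add, LinearMap.add_apply, hx, hx']
  | hword a l =>
    induction y using word_induction with
    | hadd y y' hy hy' => simp only [map_add, LinearMap.add_apply, hy, hy']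
    | hword b l' =>
      induction z using word_induction with
      | hadd z z' hz hz' => simp only [map_add, hz, hz']
      | hword c l'' => exact mul_assoc_word _ a b c l l' l'' le_rfl

end Structure

end ShN

namespace ShN

universe u v w

/-! ### Linear maps defined by recursion on the first letter, and Nijenhuis operators. -/

section Rec

variable {k : Type u} [CommRing k] {A : Type v} [CommRing A] [Algebra k A]
variable {M : Type w} [AddCommMonoid M] [Module k M]

/-- The linear map on `A^{⊗ (n + 1)}` with `a ↦ f a` and `a ⊗ w ↦ g a (image of w)`. -/
def recAux (f : A →ₗ[k] M) (g : A →ₗ[k] M →ₗ[k] M) : (n : ℕ) → (⨂[k]^(n + 1) A) →ₗ[k] M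
  | 0 => f ∘ₗ (oneEquiv k A).toLinearMap
  | n + 1 => TensorProduct.lift (g.compl₂ (recAux f g n)) ∘ₗ uncons k A n

/-- The linear map on `Ш_N(A)` with `a ↦ f a` and `a ⊗ w ↦ g a (image of w)`. -/
def recLin (f : A →ₗ[k] M) (g : A →ₗ[k] M →ₗ[k] M) : Carrier k A →ₗ[k] M :=
  DirectSum.toModule k ℕ _ (recAux f g)

theorem recLin_j (f : A →ₗ[k] M) (g : A →ₗ[k] M →ₗ[k] M) (a : A) :
    recLin f g (j k A a) = f a := by
  simp [recLin, j_apply, recAux]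

theorem recLin_consAll (f : A →ₗ[k] M) (g : A →ₗ[k] M →ₗ[k] M) (a : A) (w : Carrier k A) :
    recLin f g (consAll k A a w) = g a (recLin f g w) := by
  induction w using DirectSum.induction_on with
  | zero => simp
  | add x y hx hy => simp only [map_add, hx, hy]
  | of n x =>
    change recLin f g (consAll k A a (incl k A n x)) = g a (recLin f g (incl k A n x))
    rw [consAll_incl]
    simp [recLin, recAux, uncons_cons]

end Rec

/-- `Q` is a Nijenhuis operator. -/
def IsNijenhuis {R : Type u} {B : Type v} [CommRing R] [CommRing B] [Algebra R B]
    (Q : B →ₗ[R] B) : Prop :=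
  ∀ x y, Q x * Q y = Q (x * Q y + Q x * y - Q (x * y))

/-- The Nijenhuis identity is invariant under adding a scalar multiple of the identity to `Q`: the
extra terms on both sides agree. The cases `-1` and `+1` provide the twist and its inverse. -/
theorem IsNijenhuis.sub_id {R : Type u} {B : Type v} [CommRing R] [CommRing B] [Algebra R B]
    {Q : B →ₗ[R] B} (h : IsNijenhuis Q) : IsNijenhuis (Q - LinearMap.id) := by
  intro x y
  have e := h x y
  simp only [map_add, map_sub, LinearMap.sub_apply, LinearMap.id_apply] at e ⊢
  simp only [mul_sub, sub_mul, map_sub]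
  rw [e]
  abel

theorem IsNijenhuis.add_id {R : Type u} {B : Type v} [CommRing R] [CommRing B] [Algebra R B]
    {Q : B →ₗ[R] B} (h : IsNijenhuis Q) : IsNijenhuis (Q + LinearMap.id) := by
  intro x y
  have e := h x y
  simp only [map_add, map_sub, LinearMap.add_apply, LinearMap.id_apply] at e ⊢
  simp only [mul_add, add_mul, map_add]
  rw [e]
  abel

theorem IsNijenhuis.lTensor {R : Type u} {B : Type v} [CommRing R] [CommRing B] [Algebra R B]
    {Q : B →ₗ[R] B} (h : IsNijenhuis Q) :
    IsNijenhuis (TensorProduct.map (LinearMap.id : B →ₗ[R] B) Q) := by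
  intro x y
  induction x using TensorProduct.induction_on with
  | zero => simp
  | add x x' hx hx' => simp only [map_add, add_mul, map_sub, hx, hx']; abel
  | tmul a b =>
    induction y using TensorProduct.induction_on with
    | zero => simp
    | add y y' hy hy' => simp only [map_add, mul_add, map_sub, hy, hy']; abel
    | tmul c d =>
      simp only [TensorProduct.map_tmul, LinearMap.id_apply, Algebra.TensorProduct.tmul_mul_tmul,
        h b d, map_add, map_sub, TensorProduct.tmul_add, TensorProduct.tmul_sub]

/-! ### Multiplicativity of maps into a Nijenhuis algebra. -/

section Hom

variable {k : Type u} [CommRing k] {A : Type v} [CommRing A] [Algebra k A]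
variable {B : Type w} [CommRing B] [Algebra k B]

/-- The recursive rule for `⋄` maps term by term to the Nijenhuis identity of `Q`; each product
inside the bracket has smaller total length. -/
theorem map_mul_word_of_nijenhuis {Q : B →ₗ[k] B} (hQ : IsNijenhuis Q) {f : A → B} (hf₁ : f 1 = 1)
    (hf : ∀ a b, f (a * b) = f a * f b) {F : Carrier k A →ₗ[k] B} (hj : ∀ a, F (j k A a) = f a)
    (hcons : ∀ a w, F (consAll k A a w) = f a * Q (F w)) (n : ℕ) (a b : A) (l l' : List A)
    (h : l.length + l'.length ≤ n) :
    F (mul k A (word k a l) (word k b l')) = F (word k a l) * F (word k b l') := by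
  induction n generalizing a b l l' with
  | zero =>
    obtain ⟨rfl, rfl⟩ : l = [] ∧ l' = [] := by
      simpa [List.length_eq_zero_iff] using h
    simp only [word, mul_j_j, hj, hf]
  | succ n ih =>
    rcases l with - | ⟨c, l⟩ <;> rcases l' with - | ⟨d, l'⟩ <;>
      simp only [List.length_cons, List.length_nil] at h
    · simp only [word, mul_j_j, hj, hf]
    · simp only [word, mul_j_consAll, hj, hcons, hf, mul_assoc]
    · simp only [word, mul_consAll_j, hj, hcons, hf]; ring
    · have hs : ∀ w, F (shift k A w) = Q (F w) := fun w => by rw [shift_apply, hcons, hf₁, one_mul]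
      have h₁ := ih c 1 l (d :: l') (by simp; omega)
      have h₂ := ih 1 d (c :: l) l' (by simp; omega)
      rw [← shift_word, hs] at h₁ h₂
      simp only [word, mul_consAll_consAll, hcons, hf]
      rw [map_sub, map_add, h₁, h₂, hs, ih c d l l' (by omega), ← hQ]
      ring

theorem map_mul_of_nijenhuis {Q : B →ₗ[k] B} (hQ : IsNijenhuis Q) {f : A → B} (hf₁ : f 1 = 1)
    (hf : ∀ a b, f (a * b) = f a * f b) {F : Carrier k A →ₗ[k] B} (hj : ∀ a, F (j k A a) = f a)
    (hcons : ∀ a w, F (consAll k A a w) = f a * Q (F w)) (x y : Carrier k A) :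
    F (mul k A x y) = F x * F y := by
  induction x using word_induction with
  | hadd x x' hx hx' => simp only [map_add, LinearMap.add_apply, hx, hx', add_mul]
  | hword a l =>
    induction y using word_induction with
    | hadd y y' hy hy' => simp only [map_add, hy, hy', mul_add]
    | hword b l' => exact map_mul_word_of_nijenhuis hQ hf₁ hf hj hcons _ a b l l' le_rfl

end Hom

/-! ### Coassociativity and left counit, on `A` and on products `a ⋄ P_r w`. -/

section Abstract

variable {k : Type u} [CommRing k]

theorem tensorMul_mul {B : Type v} [CommRing B] [Algebra k B] (x y : B ⊗[k] B) :
    LeftCounital.tensorMul (LinearMap.mul k B) x y = x * y := by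
  induction x using TensorProduct.induction_on with
  | zero => simp
  | add x x' hx hx' => rw [map_add, LinearMap.add_apply, hx, hx', add_mul]
  | tmul a b =>
    induction y using TensorProduct.induction_on with
    | zero => simp
    | add y y' hy hy' => rw [map_add, hy, hy', mul_add]
    | tmul c d => simp [LeftCounital.tensorMul]

variable {B : Type v} [AddCommGroup B] [Module k B] {C : Type w} [AddCommGroup C] [Module k C]

theorem coassoc_of_comul_comp {j : C →ₗ[k] B} {ΔC : C →ₗ[k] C ⊗[k] C} {Δ : B →ₗ[k] B ⊗[k] B}
    (hj : ∀ a, Δ (j a) = TensorProduct.map j j (ΔC a)) {a : C}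
    (h : TensorProduct.assoc k C C C (TensorProduct.map ΔC LinearMap.id (ΔC a)) =
      TensorProduct.map LinearMap.id ΔC (ΔC a)) :
    TensorProduct.assoc k B B B (TensorProduct.map Δ LinearMap.id (Δ (j a))) =
      TensorProduct.map LinearMap.id Δ (Δ (j a)) := by
  have e : ∀ t, TensorProduct.assoc k B B B (TensorProduct.map Δ LinearMap.id
      (TensorProduct.map j j t)) = TensorProduct.map j (TensorProduct.map j j)
        (TensorProduct.assoc k C C C (TensorProduct.map ΔC LinearMap.id t)) := by
    intro t
    induction t using TensorProduct.induction_on with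
    | zero => simp
    | add x y hx hy => simp only [map_add, hx, hy]
    | tmul x y =>
      simp only [TensorProduct.map_tmul, hj, LinearMap.id_apply]
      induction ΔC x using TensorProduct.induction_on with
      | zero => simp
      | add x y hx hy => simp only [TensorProduct.add_tmul, map_add, hx, hy]
      | tmul x z => simp
  have e' : ∀ t, TensorProduct.map LinearMap.id Δ (TensorProduct.map j j t) =
      TensorProduct.map j (TensorProduct.map j j) (TensorProduct.map LinearMap.id ΔC t) := by
    intro t
    induction t using TensorProduct.induction_on with
    | zero => simp
    | add x y hx hy => simp only [map_add, hx, hy]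
    | tmul x y => simp [hj]
  rw [hj, e, e', h]

theorem coassoc_add {Δ : B →ₗ[k] B ⊗[k] B} {x y : B}
    (hx : TensorProduct.assoc k B B B (TensorProduct.map Δ LinearMap.id (Δ x)) =
      TensorProduct.map LinearMap.id Δ (Δ x))
    (hy : TensorProduct.assoc k B B B (TensorProduct.map Δ LinearMap.id (Δ y)) =
      TensorProduct.map LinearMap.id Δ (Δ y)) :
    TensorProduct.assoc k B B B (TensorProduct.map Δ LinearMap.id (Δ (x + y))) =
      TensorProduct.map LinearMap.id Δ (Δ (x + y)) := by
  simp only [map_add, hx, hy]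

theorem left_counit_of_comul_comp {j : C →ₗ[k] B} {ΔC : C →ₗ[k] C ⊗[k] C}
    {Δ : B →ₗ[k] B ⊗[k] B} (hj : ∀ a, Δ (j a) = TensorProduct.map j j (ΔC a))
    {εC : C →ₗ[k] k} {ε : B →ₗ[k] k} (hε : ∀ a, ε (j a) = εC a) {a : C}
    (h : TensorProduct.map εC LinearMap.id (ΔC a) = (1 : k) ⊗ₜ[k] a) :
    TensorProduct.map ε LinearMap.id (Δ (j a)) = (1 : k) ⊗ₜ[k] j a := by
  have e : ∀ t, TensorProduct.map ε LinearMap.id (TensorProduct.map j j t) =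
      TensorProduct.map LinearMap.id j (TensorProduct.map εC LinearMap.id t) := by
    intro t
    induction t using TensorProduct.induction_on with
    | zero => simp
    | add x y hx hy => simp only [map_add, hx, hy]
    | tmul x y => simp [hε]
  rw [hj, e, h]
  simp

end Abstract

section AbstractRing

variable {k : Type u} [CommRing k] {B : Type v} [CommRing B] [Algebra k B]

/-- Both iterated coproducts are algebra homomorphisms, and both turn `P` into `id ⊗ id ⊗ P`. They
agree on `a * P w` if they agree on `a` and on `w`. -/
theorem coassoc_mul (Δ : B →ₐ[k] B ⊗[k] B) {P : B →ₗ[k] B}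
    (hP : ∀ x, Δ.toLinearMap (P x) = TensorProduct.map LinearMap.id P (Δ.toLinearMap x)) {a w : B}
    (ha : TensorProduct.assoc k B B B (TensorProduct.map Δ.toLinearMap LinearMap.id
      (Δ.toLinearMap a)) = TensorProduct.map LinearMap.id Δ.toLinearMap (Δ.toLinearMap a))
    (hw : TensorProduct.assoc k B B B (TensorProduct.map Δ.toLinearMap LinearMap.id
      (Δ.toLinearMap w)) = TensorProduct.map LinearMap.id Δ.toLinearMap (Δ.toLinearMap w)) :
    TensorProduct.assoc k B B B (TensorProduct.map Δ.toLinearMap LinearMap.id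
      (Δ.toLinearMap (a * P w))) =
        TensorProduct.map LinearMap.id Δ.toLinearMap (Δ.toLinearMap (a * P w)) := by
  let L := (Algebra.TensorProduct.assoc k k k B B B).toAlgHom.comp
    (Algebra.TensorProduct.map Δ (AlgHom.id k B))
  let R := Algebra.TensorProduct.map (AlgHom.id k B) Δ
  have hL' : ∀ t, TensorProduct.assoc k B B B (TensorProduct.map Δ.toLinearMap LinearMap.id t) =
    L t := fun _ => rfl
  have hR' : ∀ t, TensorProduct.map LinearMap.id Δ.toLinearMap t = R t := fun _ => rfl
  -- Here `Δ` acts on the left factor and `P` on the right one, so no compatibility between them is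
  -- needed, unlike in `hR`.
  have hL : ∀ t, L (TensorProduct.map LinearMap.id P t) =
      TensorProduct.map LinearMap.id (TensorProduct.map LinearMap.id P) (L t) := by
    intro t
    induction t using TensorProduct.induction_on with
    | zero => simp only [map_zero]
    | add x y hx hy => simp only [map_add, hx, hy]
    | tmul x y =>
      rw [← hL', ← hL']
      simp only [TensorProduct.map_tmul, LinearMap.id_apply]
      induction Δ.toLinearMap x using TensorProduct.induction_on with
      | zero => simp only [TensorProduct.zero_tmul, map_zero]
      | add x y hx hy => simp only [TensorProduct.add_tmul, map_add, hx, hy]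
      | tmul x z => simp
  have hR : ∀ t, R (TensorProduct.map LinearMap.id P t) =
      TensorProduct.map LinearMap.id (TensorProduct.map LinearMap.id P) (R t) := by
    intro t
    induction t using TensorProduct.induction_on with
    | zero => simp only [map_zero]
    | add x y hx hy => simp only [map_add, hx, hy]
    | tmul x y =>
      rw [← hR', ← hR']
      simp only [TensorProduct.map_tmul, LinearMap.id_apply, hP]
  rw [hL', hR'] at ha hw ⊢
  have e : Δ.toLinearMap (a * P w) =
      Δ.toLinearMap a * TensorProduct.map LinearMap.id P (Δ.toLinearMap w) := by
    rw [← hP]; exact map_mul Δ a (P w)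
  rw [e, map_mul, map_mul, ha, hL, hR, hw]

theorem left_counit_mul (Δ : B →ₐ[k] B ⊗[k] B) (ε : B →ₐ[k] k) {P : B →ₗ[k] B}
    (hP : ∀ x, Δ.toLinearMap (P x) = TensorProduct.map LinearMap.id P (Δ.toLinearMap x)) {a w : B}
    (ha : TensorProduct.map ε.toLinearMap LinearMap.id (Δ.toLinearMap a) = (1 : k) ⊗ₜ[k] a)
    (hw : TensorProduct.map ε.toLinearMap LinearMap.id (Δ.toLinearMap w) = (1 : k) ⊗ₜ[k] w) :
    TensorProduct.map ε.toLinearMap LinearMap.id (Δ.toLinearMap (a * P w)) =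
      (1 : k) ⊗ₜ[k] (a * P w) := by
  let L := Algebra.TensorProduct.map ε (AlgHom.id k B)
  have hL' : ∀ t, TensorProduct.map ε.toLinearMap LinearMap.id t = L t := fun _ => rfl
  have hL : ∀ t, L (TensorProduct.map LinearMap.id P t) =
      TensorProduct.map LinearMap.id P (L t) := by
    intro t
    induction t using TensorProduct.induction_on with
    | zero => simp only [map_zero]
    | add x y hx hy => simp only [map_add, hx, hy]
    | tmul x y => rfl
  rw [hL'] at ha hw ⊢
  have e : Δ.toLinearMap (a * P w) =
      Δ.toLinearMap a * TensorProduct.map LinearMap.id P (Δ.toLinearMap w) := by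
    rw [← hP]; exact map_mul Δ a (P w)
  rw [e, map_mul, ha, hL, hw]
  simp

end AbstractRing

/-! ### The bialgebra structure of Ш_N(A). -/

section Coalgebra

variable {k : Type u} [CommRing k] {A : Type v} [CommRing A] [Algebra k A]

theorem comul_j (ΔA : A →ₗ[k] A ⊗[k] A) (a : A) :
    comul k ΔA (j k A a) = TensorProduct.map (j k A) (j k A) (ΔA a) := by
  simp [comul, j_apply k a, comulAux]

theorem comul_consAll_tensorMul (ΔA : A →ₗ[k] A ⊗[k] A) (a : A) (w : Carrier k A) :
    comul k ΔA (consAll k A a w) = LeftCounital.tensorMul (mul k A)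
      (TensorProduct.map (j k A) (j k A) (ΔA a))
      (TensorProduct.map LinearMap.id (shift k A) (comul k ΔA w)) := by
  induction w using DirectSum.induction_on with
  | zero => simp
  | add x y hx hy => simp only [map_add, hx, hy]
  | of n x =>
    change comul k ΔA (consAll k A a (incl k A n x)) = LeftCounital.tensorMul (mul k A) _
      (TensorProduct.map LinearMap.id (shift k A) (comul k ΔA (incl k A n x)))
    rw [consAll_incl]
    simp [comul, comulAux, uncons_cons]

theorem counit_j (εA : A →ₗ[k] k) (a : A) : counit k εA (j k A a) = εA a := by
  obtain ⟨x, rfl⟩ := (oneEquiv k A).surjective a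
  rw [j_oneEquiv]
  induction x using PiTensorProduct.induction_on with
  | smul_tprod r f => simp [counit, oneEquiv_tprod]
  | add x y hx hy => simp only [map_add, hx, hy]

theorem counit_consAll (εA : A →ₗ[k] k) (a : A) (w : Carrier k A) :
    counit k εA (consAll k A a w) = εA a * counit k εA w := by
  induction w using DirectSum.induction_on with
  | zero => simp
  | add x y hx hy => simp only [map_add, hx, hy, mul_add]
  | of n x =>
    change counit k εA (consAll k A a (incl k A n x)) = _ * counit k εA (incl k A n x)
    rw [consAll_incl]
    induction x using PiTensorProduct.induction_on with
    | smul_tprod r f => simp [counit, cons_tprod, Fin.prod_univ_succ]; ring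
    | add x y hx hy => simp only [map_add, hx, hy, mul_add]

end Coalgebra

section Ring

variable (k : Type u) [CommRing k] (A : Type v) [CommRing A] [Algebra k A]

/-- `Ш_N(A)` as a commutative ring. -/
abbrev commRing : CommRing (Carrier k A) :=
  { (inferInstance : AddCommGroup (Carrier k A)) with
    mul := fun x y => mul k A x y
    one := unit k A 1
    mul_assoc := ShN.mul_assoc
    mul_comm := ShN.mul_comm
    one_mul := mul_one_left
    mul_one := fun x => (ShN.mul_comm x _).trans (mul_one_left x)
    left_distrib := fun x y z => map_add (mul k A x) y z
    right_distrib := fun x y z => LinearMap.map_add₂ (mul k A) x y z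
    zero_mul := fun x => LinearMap.map_zero₂ (mul k A) x
    mul_zero := fun x => map_zero (mul k A x) }

attribute [local instance] commRing

/-- `Ш_N(A)` as a `k`-algebra. -/
abbrev algebra : Algebra k (Carrier k A) :=
  Algebra.ofModule (fun r x y => LinearMap.map_smul₂ (mul k A) r x y)
    (fun r x y => map_smul (mul k A x) r y)

attribute [local instance] algebra

variable {k A}

theorem mul_eq (x y : Carrier k A) : mul k A x y = x * y := rfl

theorem unit_one : unit k A 1 = 1 := rfl

theorem j_one : j k A 1 = 1 := by rw [← unit_one]; simp [unit]

theorem tensorMul_eq (x y : Carrier k A ⊗[k] Carrier k A) :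
    LeftCounital.tensorMul (mul k A) x y = x * y :=
  tensorMul_mul x y

theorem isNijenhuis_shift : IsNijenhuis (shift k A) := mul_shift_shift

theorem consAll_eq (a : A) (w : Carrier k A) : consAll k A a w = j k A a * shift k A w := by
  rw [← mul_eq, shift_apply, mul_j_consAll, mul_one]

theorem comul_consAll (ΔA : A →ₗ[k] A ⊗[k] A) (a : A) (w : Carrier k A) :
    comul k ΔA (consAll k A a w) = TensorProduct.map (j k A) (j k A) (ΔA a) *
      TensorProduct.map LinearMap.id (shift k A) (comul k ΔA w) :=
  (comul_consAll_tensorMul ΔA a w).trans (tensorMul_eq _ _)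

theorem map_j_mul (x y : A ⊗[k] A) : TensorProduct.map (j k A) (j k A) (x * y) =
    TensorProduct.map (j k A) (j k A) x * TensorProduct.map (j k A) (j k A) y := by
  induction x using TensorProduct.induction_on with
  | zero => simp
  | add x x' hx hx' => simp only [map_add, add_mul, hx, hx']
  | tmul a b =>
    induction y using TensorProduct.induction_on with
    | zero => simp
    | add y y' hy hy' => simp only [map_add, mul_add, hy, hy']
    | tmul c d => simp [← mul_eq, mul_j_j]

variable {ΔA : A →ₗ[k] A ⊗[k] A} {εA : A →ₗ[k] k}

theorem comul_mul (h₁ : ΔA 1 = 1) (h : ∀ a b, ΔA (a * b) = ΔA a * ΔA b) (x y : Carrier k A) :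
    comul k ΔA (x * y) = comul k ΔA x * comul k ΔA y :=
  map_mul_of_nijenhuis (isNijenhuis_shift.lTensor)
    (f := fun a => TensorProduct.map (j k A) (j k A) (ΔA a))
    (by simp [h₁, Algebra.TensorProduct.one_def, j_one]) (fun a b => by rw [h, map_j_mul])
    (comul_j ΔA) (comul_consAll ΔA) x y

theorem counit_mul (h₁ : εA 1 = 1) (h : ∀ a b, εA (a * b) = εA a * εA b) (x y : Carrier k A) :
    counit k εA (x * y) = counit k εA x * counit k εA y :=
  map_mul_of_nijenhuis (Q := (LinearMap.id : k →ₗ[k] k)) (fun x y => by simp)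
    h₁ h (counit_j εA) (counit_consAll εA) x y

theorem comul_one (h₁ : ΔA 1 = 1) : comul k ΔA 1 = 1 := by
  rw [← j_one, comul_j, h₁]; simp [Algebra.TensorProduct.one_def, j_one]

theorem comul_shift (h₁ : ΔA 1 = 1) (w : Carrier k A) :
    comul k ΔA (shift k A w) =
      TensorProduct.map LinearMap.id (shift k A) (comul k ΔA w) := by
  rw [shift_apply, comul_consAll, h₁]
  rw [Algebra.TensorProduct.one_def, TensorProduct.map_tmul, j_one,
    ← Algebra.TensorProduct.one_def, one_mul]

theorem counit_shift (h₁ : εA 1 = 1) (w : Carrier k A) :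
    counit k εA (shift k A w) = counit k εA w := by
  rw [shift_apply, counit_consAll, h₁, one_mul]

theorem comul_coassoc (h₁ : ΔA 1 = 1) (h : ∀ a b, ΔA (a * b) = ΔA a * ΔA b)
    (hc : ∀ x, TensorProduct.assoc k A A A (TensorProduct.map ΔA LinearMap.id (ΔA x)) =
      TensorProduct.map LinearMap.id ΔA (ΔA x)) (x : Carrier k A) :
    TensorProduct.assoc k _ _ _ (TensorProduct.map (comul k ΔA) LinearMap.id (comul k ΔA x)) =
      TensorProduct.map LinearMap.id (comul k ΔA) (comul k ΔA x) := by
  induction x using carrier_induction with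
  | hj a => exact coassoc_of_comul_comp (comul_j ΔA) (hc a)
  | hadd x y hx hy => exact coassoc_add hx hy
  | hcons a w hw =>
    rw [consAll_eq]
    have hja := coassoc_of_comul_comp (comul_j ΔA) (hc a)
    have := coassoc_mul (AlgHom.ofLinearMap (comul k ΔA) (comul_one h₁) (comul_mul h₁ h))
      (P := shift k A) (a := j k A a) (w := w) (comul_shift h₁)
    exact this hja hw

theorem comul_left_counit (h₁ : ΔA 1 = 1) (h : ∀ a b, ΔA (a * b) = ΔA a * ΔA b)
    (h₁' : εA 1 = 1) (h' : ∀ a b, εA (a * b) = εA a * εA b)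
    (hc : ∀ x, TensorProduct.map εA LinearMap.id (ΔA x) = (1 : k) ⊗ₜ[k] x) (x : Carrier k A) :
    TensorProduct.map (counit k εA) LinearMap.id (comul k ΔA x) = (1 : k) ⊗ₜ[k] x := by
  induction x using carrier_induction with
  | hj a => exact left_counit_of_comul_comp (comul_j ΔA) (counit_j εA) (hc a)
  | hadd x y hx hy => simp only [map_add, TensorProduct.tmul_add, hx, hy]
  | hcons a w hw =>
    rw [consAll_eq]
    exact left_counit_mul (AlgHom.ofLinearMap (comul k ΔA) (comul_one h₁) (comul_mul h₁ h))
      (AlgHom.ofLinearMap (counit k εA) (by rw [← j_one, counit_j, h₁']) (counit_mul h₁' h'))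
      (comul_shift h₁) (left_counit_of_comul_comp (comul_j ΔA) (counit_j εA) (hc a)) hw

theorem isBialgebra (hA : LeftCounital.IsBialgebra
      (LinearMap.mul k A) (Algebra.linearMap k A) ΔA εA) :
    LeftCounital.IsBialgebra (mul k A) (unit k A) (comul k ΔA) (counit k εA) := by
  have hΔ₁ : ΔA 1 = 1 := by simpa [Algebra.TensorProduct.one_def] using hA.comul_one
  have hΔ : ∀ a b, ΔA (a * b) = ΔA a * ΔA b := fun a b =>
    (hA.comul_mul a b).trans (tensorMul_mul _ _)
  have hε₁ : εA 1 = 1 := by simpa using hA.counit_one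
  have hε : ∀ a b, εA (a * b) = εA a * εA b := hA.counit_mul
  exact
    { mul_assoc := ShN.mul_assoc
      mul_comm := ShN.mul_comm
      one_mul := mul_one_left
      comul_mul := fun x y => (comul_mul hΔ₁ hΔ x y).trans (tensorMul_eq _ _).symm
      comul_one := comul_one hΔ₁
      counit_mul := counit_mul hε₁ hε
      counit_one := by rw [unit_one, ← j_one, counit_j, hε₁]
      coassoc := comul_coassoc hΔ₁ hΔ hA.coassoc
      left_counit := comul_left_counit hΔ₁ hΔ hε₁ hε hA.left_counit }

end Ring

end ShN

namespace LeftCounital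

universe u v w

/-! ### Degrees in the tensor square. -/

section Semiring

variable {k : Type u} [CommRing k] {H : Type v} [AddCommMonoid H] [Module k H]
variable {M : Type w} [AddCommMonoid M] [Module k M]

theorem exists_linearMap_of_isInternal {G : ℕ → Submodule k H} (hG : DirectSum.IsInternal G)
    (f : ℕ → H →ₗ[k] M) : ∃ S : H →ₗ[k] M, ∀ n, ∀ x ∈ G n, S x = f n x := by
  let e := LinearEquiv.ofBijective (DirectSum.coeLinearMap G) hG
  refine ⟨DirectSum.toModule k ℕ M (fun n => f n ∘ₗ (G n).subtype) ∘ₗ e.symm.toLinearMap, ?_⟩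
  intro n x hx
  have : e.symm x = DirectSum.lof k ℕ (fun n => G n) n ⟨x, hx⟩ := by
    rw [LinearEquiv.symm_apply_eq]
    exact (DirectSum.coeLinearMap_lof G n ⟨x, hx⟩).symm
  simp [this]

theorem tensorSub_le {P Q : Submodule k H} {V : Submodule k (H ⊗[k] H)}
    (h : ∀ x ∈ P, ∀ y ∈ Q, x ⊗ₜ[k] y ∈ V) : tensorSub P Q ≤ V :=
  Submodule.map₂_le.2 h

theorem tmul_mem_tensorSub {P Q : Submodule k H} {x y : H} (hx : x ∈ P) (hy : y ∈ Q) :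
    x ⊗ₜ[k] y ∈ tensorSub P Q :=
  Submodule.apply_mem_map₂ _ hx hy

/-- The submodule `G 0 ⊗ G n + ∑_{p + q = n, p > 0, q > 0} G p ⊗ G q`. -/
def comulTarget (G : ℕ → Submodule k H) (n : ℕ) : Submodule k (H ⊗[k] H) :=
  tensorSub (G 0) (G n) ⊔
    ⨆ (p : ℕ) (q : ℕ) (_ : p + q = n ∧ 0 < p ∧ 0 < q), tensorSub (G p) (G q)

/-- The allowed bidegrees are those with `p = 0` or `q > 0`; only `(n, 0)` with `n > 0` is excluded.
In this form they are visibly closed under addition and under raising `q`, which is all that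
products and `id ⊗ P_r` require. -/
theorem tmul_mem_comulTarget {G : ℕ → Submodule k H} {n p q : ℕ} (h : p + q = n)
    (hpq : p = 0 ∨ 0 < q) {x y : H} (hx : x ∈ G p) (hy : y ∈ G q) :
    x ⊗ₜ[k] y ∈ comulTarget G n := by
  rcases Nat.eq_zero_or_pos p with rfl | hp
  · obtain rfl : q = n := by omega
    exact Submodule.mem_sup_left (tmul_mem_tensorSub hx hy)
  · refine Submodule.mem_sup_right ?_
    exact Submodule.mem_iSup_of_mem p (Submodule.mem_iSup_of_mem q
      (Submodule.mem_iSup_of_mem ⟨h, hp, by omega⟩ (tmul_mem_tensorSub hx hy)))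

theorem comulTarget_le {G : ℕ → Submodule k H} {n : ℕ} {V : Submodule k (H ⊗[k] H)}
    (h : ∀ p q, p + q = n → (p = 0 ∨ 0 < q) → ∀ x ∈ G p, ∀ y ∈ G q, x ⊗ₜ[k] y ∈ V) :
    comulTarget G n ≤ V :=
  sup_le (tensorSub_le (h 0 n (zero_add n) (Or.inl rfl)))
    (iSup_le fun p => iSup_le fun q => iSup_le fun hpq =>
      tensorSub_le (h p q hpq.1 (Or.inr hpq.2.2)))

theorem tensorMul_mem_comulTarget {G : ℕ → Submodule k H} {m : H →ₗ[k] H →ₗ[k] H}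
    (hm : ∀ p q x y, x ∈ G p → y ∈ G q → m x y ∈ G (p + q)) {n n' : ℕ} {s t : H ⊗[k] H}
    (hs : s ∈ comulTarget G n) (ht : t ∈ comulTarget G n') :
    tensorMul m s t ∈ comulTarget G (n + n') := by
  have key : comulTarget G n ≤ (comulTarget G (n + n')).comap ((tensorMul m).flip t) := by
    refine comulTarget_le fun p q hpq hp x hx y hy => ?_
    have : comulTarget G n' ≤ (comulTarget G (n + n')).comap (tensorMul m (x ⊗ₜ y)) := by
      refine comulTarget_le fun p' q' hpq' hp' x' hx' y' hy' => ?_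
      simp only [Submodule.mem_comap, tensorMul, TensorProduct.map₂_apply_tmul]
      exact tmul_mem_comulTarget (p := p + p') (q := q + q') (by omega) (by omega)
        (hm _ _ _ _ hx hx') (hm _ _ _ _ hy hy')
    exact this ht
  exact key hs

theorem map_mem_comulTarget {M : Type w} [AddCommMonoid M] [Module k M] {G : ℕ → Submodule k H}
    {U : ℕ → Submodule k M} {f : H →ₗ[k] M} (hf : ∀ n, ∀ x ∈ G n, f x ∈ U n) {n : ℕ}
    {t : H ⊗[k] H} (ht : t ∈ comulTarget G n) :
    TensorProduct.map f f t ∈ comulTarget U n := by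
  have : comulTarget G n ≤ (comulTarget U n).comap (TensorProduct.map f f) :=
    comulTarget_le fun p q hpq hp x hx y hy =>
      tmul_mem_comulTarget hpq hp (hf p x hx) (hf q y hy)
  exact this ht

theorem lTensor_mem_comulTarget {G : ℕ → Submodule k H} {f : H →ₗ[k] H}
    (hf : ∀ n, ∀ x ∈ G n, f x ∈ G (n + 1)) {n : ℕ} {t : H ⊗[k] H} (ht : t ∈ comulTarget G n) :
    TensorProduct.map LinearMap.id f t ∈ comulTarget G (n + 1) := by
  have : comulTarget G n ≤ (comulTarget G (n + 1)).comap (TensorProduct.map LinearMap.id f) :=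
    comulTarget_le fun p q hpq hp x hx y hy =>
      tmul_mem_comulTarget (q := q + 1) (by omega) (by omega) hx (hf q y hy)
  exact this ht

end Semiring

/-! ### Transport of gradings, connectedness and the antipode. -/

section Ring

variable {k : Type u} [CommRing k] {H : Type v} [AddCommGroup H] [Module k H]
variable {m : H →ₗ[k] H →ₗ[k] H} {u : k →ₗ[k] H} {Δ : H →ₗ[k] H ⊗[k] H} {ε : H →ₗ[k] k}
variable {G : ℕ → Submodule k H}

theorem IsGradedBialgebra.map (h : IsGradedBialgebra m u Δ ε G) (Φ : H ≃ₗ[k] H)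
    (hm : ∀ x y, Φ (m x y) = m (Φ x) (Φ y))
    (hΔ : ∀ x, Δ (Φ x) = TensorProduct.map Φ.toLinearMap Φ.toLinearMap (Δ x)) :
    IsGradedBialgebra m u Δ ε (fun n => (G n).map Φ.toLinearMap) where
  toIsBialgebra := h.toIsBialgebra
  isInternal := by
    have hG := h.isInternal
    rw [DirectSum.isInternal_submodule_iff_iSupIndep_and_iSup_eq_top] at hG ⊢
    refine ⟨hG.1.map_orderIso (Submodule.orderIsoMapComap Φ), ?_⟩
    rw [← Submodule.map_iSup, hG.2, Submodule.map_top, LinearEquiv.range]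
  mul_mem := by
    rintro p q _ _ ⟨x, hx, rfl⟩ ⟨y, hy, rfl⟩
    exact ⟨m x y, h.mul_mem p q x y hx hy, hm x y⟩
  comul_mem := by
    rintro n _ ⟨x, hx, rfl⟩
    have := map_mem_comulTarget (U := fun n => (G n).map Φ.toLinearMap) (f := Φ.toLinearMap)
      (fun n x hx => Submodule.mem_map_of_mem hx) (h.comul_mem n x hx)
    rw [← hΔ] at this
    exact this

/-- Only one inclusion of `ker ε = ⨁_{n ≥ 1} G n` has to be supplied. Any `x` is `u c + z` with `z`
of positive degrees, and `ε x = c`, so `ε x = 0` forces `x = z`. -/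
theorem IsGradedBialgebra.isConnected (h : IsGradedBialgebra m u Δ ε G)
    (h₀ : G 0 = LinearMap.range u) (hε : ∀ n, 1 ≤ n → G n ≤ LinearMap.ker ε) :
    IsConnectedGradedBialgebra m u Δ ε G where
  toIsGradedBialgebra := h
  zero_eq := h₀
  ker_counit := by
    refine le_antisymm (fun x hx => ?_) (iSup_le fun n => iSup_le fun hn => hε n hn)
    have htop : G 0 ⊔ ⨆ (n : ℕ) (_ : 1 ≤ n), G n = ⊤ := by
      rw [eq_top_iff, ← h.isInternal.submodule_iSup_eq_top]
      refine iSup_le fun n => ?_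
      rcases n with - | n
      · exact le_sup_left
      · exact le_sup_of_le_right (le_iSup₂_of_le (n + 1) (by omega) le_rfl)
    have hx' : x ∈ G 0 ⊔ ⨆ (n : ℕ) (_ : 1 ≤ n), G n := htop ▸ Submodule.mem_top
    obtain ⟨y, hy, z, hz, rfl⟩ := Submodule.mem_sup.1 hx'
    rw [h₀] at hy
    obtain ⟨c, rfl⟩ := hy
    have hz' : ε z = 0 := (iSup_le fun n => iSup_le fun hn => hε n hn :
      (⨆ (n : ℕ) (_ : 1 ≤ n), G n) ≤ LinearMap.ker ε) hz
    have huc : u c = c • u 1 := by rw [← map_smul, smul_eq_mul, mul_one]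
    have hc : c = 0 := by
      simpa [hz', huc, h.counit_one] using LinearMap.mem_ker.1 hx
    simpa [hc] using hz

/-- As `G 0` is spanned by the unit, the extreme part of `Δ x` is `1 ⊗ b` for some `b`. Applying `ε
⊗ id` kills the terms with `p > 0`, and the left counit property gives `b = x`. -/
theorem IsConnectedGradedBialgebra.comul_sub_mem (h : IsConnectedGradedBialgebra m u Δ ε G)
    {n : ℕ} {x : H} (hx : x ∈ G n) : Δ x - u 1 ⊗ₜ[k] x ∈
      ⨆ (p : ℕ) (q : ℕ) (_ : p + q = n ∧ 0 < p ∧ 0 < q), tensorSub (G p) (G q) := by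
  have hu : ∀ c, u c = c • u 1 := fun c => by rw [← map_smul, smul_eq_mul, mul_one]
  obtain ⟨y, hy, z, hz, hyz⟩ := Submodule.mem_sup.1 (h.comul_mem n x hx)
  have hy' : tensorSub (G 0) (G n) ≤
      LinearMap.range (TensorProduct.mk k H H (u 1)) := by
    refine tensorSub_le fun a ha b _ => ?_
    rw [h.zero_eq] at ha
    obtain ⟨c, rfl⟩ := ha
    exact ⟨c • b, by rw [hu c, TensorProduct.mk_apply, TensorProduct.smul_tmul]⟩
  obtain ⟨b, rfl⟩ := hy' hy
  have hz' : (⨆ (p : ℕ) (q : ℕ) (_ : p + q = n ∧ 0 < p ∧ 0 < q), tensorSub (G p) (G q)) ≤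
      LinearMap.ker (TensorProduct.map ε (LinearMap.id : H →ₗ[k] H)) := by
    refine iSup_le fun p => iSup_le fun q => iSup_le fun hpq => tensorSub_le fun a ha c _ => ?_
    have : a ∈ LinearMap.ker ε := by
      rw [h.ker_counit]
      exact Submodule.mem_iSup_of_mem p (Submodule.mem_iSup_of_mem hpq.2.1 ha)
    rw [LinearMap.mem_ker, TensorProduct.map_tmul, LinearMap.mem_ker.1 this,
      TensorProduct.zero_tmul]
  have e := h.left_counit x
  rw [← hyz, map_add, LinearMap.mem_ker.1 (hz' hz), add_zero, TensorProduct.mk_apply,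
    TensorProduct.map_tmul, h.counit_one] at e
  have e' : b = x := by simpa using congrArg (TensorProduct.lid k H) e
  rw [← hyz, e', TensorProduct.mk_apply, add_sub_cancel_left]
  exact hz

theorem IsConnectedGradedBialgebra.exists_rightAntipode
    (h : IsConnectedGradedBialgebra m u Δ ε G) : ∃ S, IsRightAntipode m u Δ ε S := by
  let D : H →ₗ[k] H ⊗[k] H := Δ - TensorProduct.mk k H H (u 1)
  -- The equation `id * S = u ε` reads `S + m (id ⊗ S) D = u ε`, so right antipodes are the fixed
  -- points of `T`. By `hT`, `T f` in degree `n` depends only on `f` in degrees below `n`.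
  let T : (H →ₗ[k] H) → H →ₗ[k] H := fun f =>
    u ∘ₗ ε - TensorProduct.lift m ∘ₗ TensorProduct.map LinearMap.id f ∘ₗ D
  have hT : ∀ (n : ℕ) (f g : H →ₗ[k] H), (∀ q < n, ∀ x ∈ G q, f x = g x) →
      ∀ x ∈ G n, T f x = T g x := by
    intro n f g hfg x hx
    have hle : (⨆ (p : ℕ) (q : ℕ) (_ : p + q = n ∧ 0 < p ∧ 0 < q), tensorSub (G p) (G q)) ≤
        LinearMap.eqLocus (TensorProduct.map (LinearMap.id : H →ₗ[k] H) f)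
          (TensorProduct.map (LinearMap.id : H →ₗ[k] H) g) := by
      refine iSup_le fun p => iSup_le fun q => iSup_le fun hpq => tensorSub_le fun a _ b hb => ?_
      rw [LinearMap.mem_eqLocus, TensorProduct.map_tmul, TensorProduct.map_tmul,
        hfg q (by omega) b hb]
    have e : TensorProduct.map LinearMap.id f (D x) = TensorProduct.map LinearMap.id g (D x) :=
      hle (h.comul_sub_mem hx)
    simp only [T, LinearMap.sub_apply, LinearMap.comp_apply, e]
  -- On `G n` the iterates are constant from the `(n + 1)`-st on; in degree zero a single step
  -- suffices, since no pair `p, q > 0` has sum zero. The stable values define `S`.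
  have hstep : ∀ n N, n < N → ∀ x ∈ G n, T^[N] 0 x = T^[n + 1] 0 x := by
    intro n
    induction n using Nat.strong_induction_on with
    | _ n ih =>
      intro N hN x hx
      obtain ⟨N, rfl⟩ : ∃ N', N = N' + 1 := ⟨N - 1, by omega⟩
      rw [Function.iterate_succ_apply', Function.iterate_succ_apply']
      refine hT n _ _ (fun q hq y hy => ?_) x hx
      rw [ih q hq N (by omega) y hy, ih q hq n hq y hy]
  obtain ⟨S, hS⟩ := exists_linearMap_of_isInternal h.isInternal (fun n => T^[n + 1] 0)
  have hTS : ∀ n, G n ≤ LinearMap.eqLocus (T S) S := by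
    intro n x hx
    rw [LinearMap.mem_eqLocus, hS n x hx, Function.iterate_succ_apply']
    refine hT n _ _ (fun q hq y hy => ?_) x hx
    rw [hS q y hy, hstep q n hq y hy]
  have hTS' : T S = S := by
    rw [← LinearMap.eqLocus_eq_top, eq_top_iff, ← h.isInternal.submodule_iSup_eq_top]
    exact iSup_le hTS
  refine ⟨S, LinearMap.ext fun x => ?_⟩
  have e := LinearMap.congr_fun hTS' x
  simp only [T, D, LinearMap.sub_apply, LinearMap.comp_apply, TensorProduct.mk_apply, map_sub,
    TensorProduct.map_tmul, TensorProduct.lift.tmul, LinearMap.id_apply, h.one_mul] at e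
  simp only [convolution, LinearMap.comp_apply]
  rw [sub_eq_iff_eq_add, add_sub_cancel] at e
  exact e.symm

end Ring

end LeftCounital

namespace LeftCounital

universe u v

theorem map_map_mul {k : Type u} [CommRing k] {B : Type v} [CommRing B] [Algebra k B]
    {F : B →ₗ[k] B} (hF : ∀ x y, F (x * y) = F x * F y) (s t : B ⊗[k] B) :
    TensorProduct.map F F (s * t) = TensorProduct.map F F s * TensorProduct.map F F t := by
  induction s using TensorProduct.induction_on with
  | zero => simp only [zero_mul, map_zero]
  | add x x' hx hx' => simp only [map_add, add_mul, hx, hx']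
  | tmul a b =>
    induction t using TensorProduct.induction_on with
    | zero => simp only [mul_zero, map_zero]
    | add y y' hy hy' => simp only [map_add, mul_add, hy, hy']
    | tmul c d => simp [hF]

end LeftCounital

namespace ShN

universe u v

/-! ### The automorphism replacing `P_r` by `P_r - id`. -/

section Twist

variable (k : Type u) [CommRing k] (A : Type v) [CommRing A] [Algebra k A]

/-- The algebra endomorphism of `Ш_N(A)` over `A` that carries `P_r` to `P_r - id`. -/
def twist : Carrier k A →ₗ[k] Carrier k A :=
  recLin (j k A) ((mul k A).compl₁₂ (j k A) (shift k A - LinearMap.id))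

/-- The algebra endomorphism of `Ш_N(A)` over `A` that carries `P_r` to `P_r + id`. -/
def untwist : Carrier k A →ₗ[k] Carrier k A :=
  recLin (j k A) ((mul k A).compl₁₂ (j k A) (shift k A + LinearMap.id))

attribute [local instance] commRing algebra

variable {k A}

theorem twist_j (a : A) : twist k A (j k A a) = j k A a := recLin_j _ _ _

theorem twist_consAll (a : A) (w : Carrier k A) : twist k A (consAll k A a w) =
    j k A a * (shift k A - LinearMap.id : Carrier k A →ₗ[k] Carrier k A) (twist k A w) :=
  recLin_consAll _ _ _ _

theorem untwist_j (a : A) : untwist k A (j k A a) = j k A a := recLin_j _ _ _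

theorem untwist_consAll (a : A) (w : Carrier k A) : untwist k A (consAll k A a w) =
    j k A a * (shift k A + LinearMap.id : Carrier k A →ₗ[k] Carrier k A) (untwist k A w) :=
  recLin_consAll _ _ _ _

theorem j_mul (a b : A) : j k A (a * b) = j k A a * j k A b := (mul_j_j a b).symm

theorem twist_mul (x y : Carrier k A) : twist k A (x * y) = twist k A x * twist k A y :=
  map_mul_of_nijenhuis isNijenhuis_shift.sub_id j_one j_mul twist_j twist_consAll x y

theorem untwist_mul (x y : Carrier k A) : untwist k A (x * y) = untwist k A x * untwist k A y :=
  map_mul_of_nijenhuis isNijenhuis_shift.add_id j_one j_mul untwist_j untwist_consAll x y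

theorem twist_shift (w : Carrier k A) :
    twist k A (shift k A w) = shift k A (twist k A w) - twist k A w := by
  rw [shift_apply, twist_consAll, j_one, one_mul]; rfl

theorem untwist_shift (w : Carrier k A) :
    untwist k A (shift k A w) = shift k A (untwist k A w) + untwist k A w := by
  rw [shift_apply, untwist_consAll, j_one, one_mul]; rfl

/-- The composite is multiplicative, fixes `A` and carries `P_r` to `(P_r + id) - id = P_r`. -/
theorem untwist_twist (w : Carrier k A) : untwist k A (twist k A w) = w := by
  induction w using carrier_induction with
  | hj a => rw [twist_j, untwist_j]
  | hadd x y hx hy => rw [map_add, map_add, hx, hy]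
  | hcons a w hw =>
    rw [twist_consAll, untwist_mul, untwist_j, consAll_eq, LinearMap.sub_apply, map_sub,
      untwist_shift, LinearMap.id_apply, hw, add_sub_cancel_right]

theorem twist_untwist (w : Carrier k A) : twist k A (untwist k A w) = w := by
  induction w using carrier_induction with
  | hj a => rw [untwist_j, twist_j]
  | hadd x y hx hy => rw [map_add, map_add, hx, hy]
  | hcons a w hw =>
    rw [untwist_consAll, twist_mul, twist_j, consAll_eq, LinearMap.add_apply, map_add,
      twist_shift, LinearMap.id_apply, hw, sub_add_cancel]

variable (k A) in
/-- The algebra automorphism of `Ш_N(A)` over `A` that carries `P_r` to `P_r - id`. -/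
def twistEquiv : Carrier k A ≃ₗ[k] Carrier k A :=
  LinearEquiv.ofLinearMap (twist k A) (untwist k A) (LinearMap.ext twist_untwist)
    (LinearMap.ext untwist_twist)

/-- Since `ε P_r = ε`, the counit vanishes on the image of `P_r - id`. This is why the twisted
grading is connected. -/
theorem counit_twist_consAll {εA : A →ₗ[k] k} (h₁ : εA 1 = 1)
    (h : ∀ a b, εA (a * b) = εA a * εA b) (a : A) (w : Carrier k A) :
    counit k εA (twist k A (consAll k A a w)) = 0 := by
  rw [twist_consAll, counit_mul h₁ h, LinearMap.sub_apply, map_sub, counit_shift h₁,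
    LinearMap.id_apply, sub_self, mul_zero]

theorem map_twist_lTensor_shift (t : Carrier k A ⊗[k] Carrier k A) :
    TensorProduct.map (twist k A) (twist k A) (TensorProduct.map LinearMap.id (shift k A) t) =
      TensorProduct.map LinearMap.id (shift k A) (TensorProduct.map (twist k A) (twist k A) t) -
        TensorProduct.map (twist k A) (twist k A) t := by
  induction t using TensorProduct.induction_on with
  | zero => simp only [map_zero, sub_zero]
  | add x y hx hy => simp only [map_add, hx, hy]; abel
  | tmul x y =>
    simp only [TensorProduct.map_tmul, LinearMap.id_apply, twist_shift, TensorProduct.tmul_sub]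

theorem map_twist_comul_j (ΔA : A →ₗ[k] A ⊗[k] A) (a : A) :
    TensorProduct.map (twist k A) (twist k A) (comul k ΔA (j k A a)) = comul k ΔA (j k A a) := by
  rw [comul_j]
  induction ΔA a using TensorProduct.induction_on with
  | zero => simp only [map_zero]
  | add x y hx hy => simp only [map_add, hx, hy]
  | tmul x y => simp only [TensorProduct.map_tmul, twist_j]

/-- Both sides are multiplicative, agree on `A` and turn `P_r` into `id ⊗ (P_r - id)`: subtracting
the identity commutes with `Δ` because `P_r` acts on the right factor only. -/
theorem comul_twist {ΔA : A →ₗ[k] A ⊗[k] A} (h₁ : ΔA 1 = 1)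
    (h : ∀ a b, ΔA (a * b) = ΔA a * ΔA b) (w : Carrier k A) :
    comul k ΔA (twist k A w) = TensorProduct.map (twist k A) (twist k A) (comul k ΔA w) := by
  induction w using carrier_induction with
  | hj a => rw [twist_j, map_twist_comul_j]
  | hadd x y hx hy => simp only [map_add, hx, hy]
  | hcons a w hw =>
    rw [twist_consAll, comul_mul h₁ h, LinearMap.sub_apply, map_sub, comul_shift h₁,
      LinearMap.id_apply, hw, comul_consAll, LeftCounital.map_map_mul twist_mul, ← comul_j,
      map_twist_comul_j, map_twist_lTensor_shift]

end Twist

/-! ### The grading by `U^(d)` and its twist. -/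

section Grading

variable {k : Type u} [CommRing k] {A : Type v} [CommRing A] [Algebra k A]

/-- `w` is a pure tensor of length `n + 1` and degree `d` of elements homogeneous for `G`. -/
inductive IsHomogeneousWord (G : ℕ → Submodule k A) : ℕ → ℕ → Carrier k A → Prop
  | single {a : A} {e : ℕ} (ha : a ∈ G e) : IsHomogeneousWord G 0 e (j k A a)
  | cons {a : A} {w : Carrier k A} {e n d : ℕ} (ha : a ∈ G e) (hw : IsHomogeneousWord G n d w) :
      IsHomogeneousWord G (n + 1) (e + d + 1) (consAll k A a w)

variable {G : ℕ → Submodule k A}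

theorem isHomogeneousWord_incl_tprod {n : ℕ} {a : Fin (n + 1) → A} {e : Fin (n + 1) → ℕ}
    (h : ∀ i, a i ∈ G (e i)) :
    IsHomogeneousWord G n (∑ i, e i + n) (incl k A n (PiTensorProduct.tprod k a)) := by
  induction n with
  | zero =>
    rw [incl_tprod_zero]
    simpa using IsHomogeneousWord.single (h 0)
  | succ n ih =>
    rw [incl_tprod_succ, Fin.sum_univ_succ, add_assoc, ← add_assoc _ n 1, ← add_assoc]
    exact .cons (h 0) (ih (a := Fin.tail a) (e := Fin.tail e) fun i => h i.succ)

theorem IsHomogeneousWord.exists_incl_tprod {n d : ℕ} {w : Carrier k A}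
    (h : IsHomogeneousWord G n d w) : ∃ (a : Fin (n + 1) → A) (e : Fin (n + 1) → ℕ),
      (∀ i, a i ∈ G (e i)) ∧ (∑ i, e i) + n = d ∧ w = incl k A n (PiTensorProduct.tprod k a) := by
  induction h with
  | @single a e ha =>
    exact ⟨fun _ => a, fun _ => e, fun _ => ha, by simp, (incl_tprod_zero k fun _ => a).symm⟩
  | @cons b w f n d hb _ ih =>
    obtain ⟨a, e, ha, hd, rfl⟩ := ih
    refine ⟨Fin.cons b a, Fin.cons f e, ?_, ?_, ?_⟩
    · intro i
      cases i using Fin.cases with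
      | zero => simpa using hb
      | succ i => simpa using ha i
    · rw [Fin.sum_univ_succ]; simp; omega
    · rw [incl_tprod_succ]; simp

theorem degSub_eq_span (d : ℕ) :
    degSub k G d = Submodule.span k {w | ∃ n, IsHomogeneousWord G n d w} := by
  refine le_antisymm (Submodule.span_mono ?_) (Submodule.span_mono ?_)
  · rintro _ ⟨n, a, e, ha, rfl, rfl⟩
    exact ⟨n, isHomogeneousWord_incl_tprod ha⟩
  · rintro _ ⟨n, hw⟩
    exact ⟨n, hw.exists_incl_tprod⟩

theorem IsHomogeneousWord.mem_degSub {n d : ℕ} {w : Carrier k A}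
    (h : IsHomogeneousWord G n d w) : w ∈ degSub k G d := by
  rw [degSub_eq_span]; exact Submodule.subset_span ⟨n, h⟩

theorem degSub_le {d : ℕ} {V : Submodule k (Carrier k A)}
    (h : ∀ n w, IsHomogeneousWord G n d w → w ∈ V) : degSub k G d ≤ V := by
  rw [degSub_eq_span, Submodule.span_le]
  rintro w ⟨n, hw⟩
  exact h n w hw

theorem j_mem_degSub {a : A} {e : ℕ} (ha : a ∈ G e) : j k A a ∈ degSub k G e :=
  (IsHomogeneousWord.single ha).mem_degSub

theorem consAll_mem_degSub {a : A} {w : Carrier k A} {e d : ℕ} (ha : a ∈ G e)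
    (hw : w ∈ degSub k G d) : consAll k A a w ∈ degSub k G (e + d + 1) := by
  have : degSub k G d ≤ (degSub k G (e + d + 1)).comap (consAll k A a) :=
    degSub_le fun n w hw => (IsHomogeneousWord.cons ha hw).mem_degSub
  exact this hw

theorem shift_mem_degSub (h₁ : (1 : A) ∈ G 0) {w : Carrier k A} {d : ℕ} (hw : w ∈ degSub k G d) :
    shift k A w ∈ degSub k G (d + 1) := by
  simpa [shift_apply] using consAll_mem_degSub h₁ hw

theorem IsHomogeneousWord.shift (h₁ : (1 : A) ∈ G 0) {n d : ℕ} {w : Carrier k A}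
    (h : IsHomogeneousWord G n d w) : IsHomogeneousWord G (n + 1) (d + 1) (shift k A w) := by
  simpa [shift_apply] using IsHomogeneousWord.cons h₁ h

theorem IsHomogeneousWord.mul_mem (h₁ : (1 : A) ∈ G 0)
    (hG : ∀ p q a b, a ∈ G p → b ∈ G q → a * b ∈ G (p + q)) (N : ℕ) {n n' d d' : ℕ}
    (hN : n + n' ≤ N) {w w' : Carrier k A} (hw : IsHomogeneousWord G n d w)
    (hw' : IsHomogeneousWord G n' d' w') : mul k A w w' ∈ degSub k G (d + d') := by
  induction N generalizing n n' d d' w w' with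
  | zero =>
    obtain ⟨rfl, rfl⟩ : n = 0 ∧ n' = 0 := by omega
    cases hw with
    | single ha =>
      cases hw' with
      | single hb => rw [mul_j_j]; exact j_mem_degSub (hG _ _ _ _ ha hb)
  | succ N ih =>
    cases hw with
    | single ha =>
      cases hw' with
      | single hb => rw [mul_j_j]; exact j_mem_degSub (hG _ _ _ _ ha hb)
      | @cons b v e' n₁ d₁ hb hv =>
        rw [mul_j_consAll, show d + (e' + d₁ + 1) = d + e' + d₁ + 1 by ring]
        exact consAll_mem_degSub (hG _ _ _ _ ha hb) hv.mem_degSub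
    | @cons a v e n d ha hv =>
      cases hw' with
      | single hb =>
        rw [mul_consAll_j, show e + d + 1 + d' = e + d' + d + 1 by ring]
        exact consAll_mem_degSub (hG _ _ _ _ ha hb) hv.mem_degSub
      | @cons b v' e' n' d' hb hv' =>
        rw [mul_consAll_consAll,
          show e + d + 1 + (e' + d' + 1) = e + e' + (d + d' + 1) + 1 by ring]
        refine consAll_mem_degSub (hG _ _ _ _ ha hb) (sub_mem (add_mem ?_ ?_) ?_)
        · rw [add_assoc d d' 1]
          exact ih (by omega) hv (hv'.shift h₁)
        · rw [show d + d' + 1 = d + 1 + d' by ring]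
          exact ih (by omega) (hv.shift h₁) hv'
        · exact shift_mem_degSub h₁ (ih (by omega) hv hv')

theorem mul_mem_degSub (h₁ : (1 : A) ∈ G 0)
    (hG : ∀ p q a b, a ∈ G p → b ∈ G q → a * b ∈ G (p + q)) {d d' : ℕ} {x y : Carrier k A}
    (hx : x ∈ degSub k G d) (hy : y ∈ degSub k G d') : mul k A x y ∈ degSub k G (d + d') := by
  have key : degSub k G d ≤ (degSub k G (d + d')).comap ((mul k A).flip y) := by
    refine degSub_le fun n w hw => ?_
    have : degSub k G d' ≤ (degSub k G (d + d')).comap (mul k A w) :=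
      degSub_le fun n' w' hw' => hw.mul_mem h₁ hG _ le_rfl hw'
    exact this hy
  exact key hx

theorem iSup_degSub (hG : ⨆ n, G n = ⊤) : ⨆ d, degSub k G d = ⊤ := by
  rw [eq_top_iff]
  rintro w -
  induction w using carrier_induction with
  | hadd x y hx hy => exact add_mem hx hy
  | hj a =>
    have : ⨆ n, G n ≤ (⨆ d, degSub k G d).comap (j k A) :=
      iSup_le fun n a ha => Submodule.mem_iSup_of_mem n (j_mem_degSub ha)
    exact this (hG ▸ Submodule.mem_top)
  | hcons a w hw =>
    have : ⨆ n, G n ≤ (⨆ d, degSub k G d).comap ((consAll k A).flip w) := by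
      refine iSup_le fun n a ha => ?_
      have : ⨆ d, degSub k G d ≤ (⨆ d, degSub k G d).comap (consAll k A a) :=
        iSup_le fun d w hw => Submodule.mem_iSup_of_mem _ (consAll_mem_degSub ha hw)
      exact this hw
    exact this (hG ▸ Submodule.mem_top)

/-- This map sorts an element into its homogeneous components, which proves the sum of the `degSub k
G d` direct. It is defined by recursion on the first letter, whose own components come from the
grading of `A`. -/
theorem exists_degree_map (hG : DirectSum.IsInternal G) :
    ∃ θ : Carrier k A →ₗ[k] ℕ →₀ Carrier k A,
      ∀ d, ∀ w ∈ degSub k G d, θ w = Finsupp.single d w := by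
  obtain ⟨f, hf⟩ := LeftCounital.exists_linearMap_of_isInternal hG
    (fun n => (Finsupp.lsingle n : Carrier k A →ₗ[k] ℕ →₀ Carrier k A) ∘ₗ j k A)
  -- Prepending a letter of degree `n` moves the component of degree `d` to degree `n + d + 1`; the
  -- extra one counts the new tensor sign.
  let gradedCons (n : ℕ) : A →ₗ[k] (ℕ →₀ Carrier k A) →ₗ[k] (ℕ →₀ Carrier k A) :=
    (Finsupp.lsum k).toLinearMap ∘ₗ LinearMap.pi fun d =>
      (LinearMap.llcomp k _ _ _ (Finsupp.lsingle (n + d + 1))) ∘ₗ consAll k A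
  have hcons : ∀ n a d w, gradedCons n a (Finsupp.single d w) =
      Finsupp.single (n + d + 1) (consAll k A a w) := by
    intro n a d w
    simp [gradedCons]
  obtain ⟨g, hg⟩ := LeftCounital.exists_linearMap_of_isInternal hG gradedCons
  refine ⟨recLin f g, fun d => ?_⟩
  suffices h : degSub k G d ≤ LinearMap.eqLocus (recLin f g) (Finsupp.lsingle d) from
    fun w hw => h hw
  refine degSub_le fun n w hw => ?_
  rw [LinearMap.mem_eqLocus, Finsupp.lsingle_apply]
  induction hw with
  | single ha => rw [recLin_j, hf _ _ ha]; rfl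
  | cons ha _ ih => rw [recLin_consAll, ih, hg _ _ ha, hcons]

theorem isInternal_degSub (hG : DirectSum.IsInternal G) :
    DirectSum.IsInternal (degSub k G) := by
  constructor
  · obtain ⟨θ, hθ⟩ := exists_degree_map hG
    have key : ∀ (x : ⨁ d, degSub k G d) (d : ℕ),
        θ (DirectSum.coeAddMonoidHom (degSub k G) x) d = x d := by
      intro x d
      induction x using DirectSum.induction_on with
      | zero => simp
      | add x y hx hy => simp [hx, hy]
      | of i y =>
        rw [DirectSum.coeAddMonoidHom_of, hθ i y y.2, DirectSum.coe_of_apply,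
          Finsupp.single_apply]
        split_ifs <;> simp
    intro x y hxy
    refine DFinsupp.ext fun d => Subtype.ext ?_
    rw [← key x d, ← key y d, hxy]
  · have := iSup_degSub hG.submodule_iSup_eq_top
    rw [Submodule.iSup_eq_range_dfinsupp_lsum] at this
    exact LinearMap.range_eq_top.1 this

theorem comul_mem_degSub {ΔA : A →ₗ[k] A ⊗[k] A} (h₁ : (1 : A) ∈ G 0)
    (hG : ∀ p q a b, a ∈ G p → b ∈ G q → a * b ∈ G (p + q))
    (hΔ : ∀ n, ∀ a ∈ G n, ΔA a ∈ LeftCounital.comulTarget G n) {d : ℕ} {x : Carrier k A}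
    (hx : x ∈ degSub k G d) : comul k ΔA x ∈ LeftCounital.comulTarget (degSub k G) d := by
  have hj : ∀ n, ∀ a ∈ G n, TensorProduct.map (j k A) (j k A) (ΔA a) ∈
      LeftCounital.comulTarget (degSub k G) n := fun n a ha =>
    LeftCounital.map_mem_comulTarget (fun _ _ => j_mem_degSub) (hΔ n a ha)
  have hmul : ∀ p q x y, x ∈ degSub k G p → y ∈ degSub k G q →
      mul k A x y ∈ degSub k G (p + q) := fun p q x y hx hy => mul_mem_degSub h₁ hG hx hy
  have hshift : ∀ n t, t ∈ LeftCounital.comulTarget (degSub k G) n →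
      TensorProduct.map LinearMap.id (shift k A) t ∈
        LeftCounital.comulTarget (degSub k G) (n + 1) := fun n t ht =>
    LeftCounital.lTensor_mem_comulTarget (fun _ _ hw => shift_mem_degSub h₁ hw) ht
  suffices h : degSub k G d ≤ (LeftCounital.comulTarget (degSub k G) d).comap (comul k ΔA) from
    h hx
  clear hx
  refine degSub_le fun n w hw => ?_
  rw [Submodule.mem_comap]
  induction hw with
  | single ha => rw [comul_j]; exact hj _ _ ha
  | cons ha _ ih =>
    rw [comul_consAll_tensorMul, add_assoc]
    exact LeftCounital.tensorMul_mem_comulTarget hmul (hj _ _ ha) (hshift _ _ ih)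

theorem degSub_zero (hG : G 0 = LinearMap.range (Algebra.linearMap k A)) :
    degSub k G 0 = LinearMap.range (unit k A) := by
  refine le_antisymm (degSub_le fun n w hw => ?_) ?_
  · generalize hd : 0 = d at hw
    cases hw with
    | single ha =>
      subst hd
      rw [hG] at ha
      obtain ⟨c, rfl⟩ := ha
      exact ⟨c, rfl⟩
    | cons => omega
  · rintro _ ⟨c, rfl⟩
    exact j_mem_degSub (hG ▸ ⟨c, rfl⟩)

theorem isGradedBialgebra {ΔA : A →ₗ[k] A ⊗[k] A} {εA : A →ₗ[k] k}
    (hA : LeftCounital.IsGradedBialgebra (LinearMap.mul k A) (Algebra.linearMap k A) ΔA εA G)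
    (h₁ : (1 : A) ∈ G 0) :
    LeftCounital.IsGradedBialgebra (mul k A) (unit k A) (comul k ΔA) (counit k εA)
      (degSub k G) where
  toIsBialgebra := isBialgebra hA.toIsBialgebra
  isInternal := isInternal_degSub hA.isInternal
  mul_mem _ _ _ _ := mul_mem_degSub h₁ hA.mul_mem
  comul_mem _ _ := comul_mem_degSub h₁ hA.mul_mem hA.comul_mem

/-- The images of the `degSub k G n` under the automorphism that carries `P_r` to `P_r - id`
form a connected grading. -/
theorem isConnectedGradedBialgebra {ΔA : A →ₗ[k] A ⊗[k] A} {εA : A →ₗ[k] k}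
    (hA : LeftCounital.IsConnectedGradedBialgebra
      (LinearMap.mul k A) (Algebra.linearMap k A) ΔA εA G) :
    LeftCounital.IsConnectedGradedBialgebra (mul k A) (unit k A) (comul k ΔA) (counit k εA)
      (fun n => (degSub k G n).map (twistEquiv k A).toLinearMap) := by
  have h₁ : (1 : A) ∈ G 0 := hA.zero_eq ▸ ⟨1, by simp⟩
  have hΔ₁ : ΔA 1 = 1 := by simpa [Algebra.TensorProduct.one_def] using hA.comul_one
  have hΔ : ∀ a b, ΔA (a * b) = ΔA a * ΔA b := fun a b =>
    (hA.comul_mul a b).trans (tensorMul_mul _ _)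
  have hε₁ : εA 1 = 1 := by simpa using hA.counit_one
  have htwist : ∀ x, twistEquiv k A (unit k A x) = unit k A x := fun x => twist_j _
  refine ((isGradedBialgebra hA.toIsGradedBialgebra h₁).map (twistEquiv k A) twist_mul
    (comul_twist hΔ₁ hΔ)).isConnected ?_ fun n hn => ?_
  · rw [degSub_zero hA.zero_eq]
    exact (LinearMap.range_comp _ _).symm.trans (congrArg LinearMap.range (LinearMap.ext htwist))
  · rw [Submodule.map_le_iff_le_comap]
    refine degSub_le fun i w hw => ?_
    rw [Submodule.mem_comap, LinearMap.mem_ker]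
    change counit k εA (twist k A w) = 0
    -- Tensors of length one lie in `ker ε` because `A` is connected and `n ≥ 1`; longer ones are
    -- killed whatever the degrees of their letters.
    cases hw with
    | @single a _ ha =>
      rw [twist_j, counit_j, ← LinearMap.mem_ker, hA.ker_counit]
      exact Submodule.mem_iSup_of_mem n (Submodule.mem_iSup_of_mem hn ha)
    | cons => exact counit_twist_consAll hε₁ hA.counit_mul _ _

end Grading

end ShN

end

theorem theorem4p7 {k : Type*} [Field k] {A : Type*} [CommRing A] [Algebra k A]
    (ΔA : A →ₗ[k] A ⊗[k] A) (εA : A →ₗ[k] k) (G : ℕ → Submodule k A)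
    (hA : LeftCounital.IsConnectedGradedBialgebra
      (LinearMap.mul k A) (Algebra.linearMap k A) ΔA εA G) :
    LeftCounital.IsGradedBialgebra
        (ShN.mul k A) (ShN.unit k A) (ShN.comul k ΔA) (ShN.counit k εA) (ShN.degSub k G) ∧
      ShN.degSub k G 0 = LinearMap.range (ShN.unit k A) ∧
      (∃ H : ℕ → Submodule k (ShN.Carrier k A), LeftCounital.IsConnectedGradedBialgebra
        (ShN.mul k A) (ShN.unit k A) (ShN.comul k ΔA) (ShN.counit k εA) H) ∧
      LeftCounital.IsHopf
        (ShN.mul k A) (ShN.unit k A) (ShN.comul k ΔA) (ShN.counit k εA) := by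
  have h := ShN.isConnectedGradedBialgebra hA
  exact ⟨ShN.isGradedBialgebra hA.toIsGradedBialgebra (hA.zero_eq ▸ ⟨1, by simp⟩),
    ShN.degSub_zero hA.zero_eq, ⟨_, h⟩, ⟨h.toIsBialgebra, h.exists_rightAntipode⟩⟩
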